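/- Graphs are finite connected multigraphs without loops; $V(G)$ and $E(G)$ denote the vertices and edges of $G$, and $g(G)=|E(G)|-|V(G)|+1$ is its genus. $G$ is $2$-edge-connected if it stays connected after deletion of any one edge. A divisor on $G$ is a function $D:V(G)\to\mathbb Z$, written $\sum_x D(x)\,(x)$; its degree is $\sum_x D(x)$, and it is effective if $D\ge 0$. The divisor of $f:V(G)\to\mathbb Z$ is $\sum_{x}\sum_{e=xy\in E(G)}(f(x)-f(y))\,(x)$; two divisors are equivalent if their difference is the divisor of some $f$, and $|D|$ is the set of effective divisors equivalent to $D$. The rank $r(D)$ is $-1$ if $|D|=\emptyset$, and otherwise the largest integer $k$ such that $|D-E|\neq\emptyset$ for every effective divisor $E$ of degree $k$. $G$ is hyperelliptic if $g(G)\ge 2$ and there is a divisor $D$ on $G$ with $\deg D=2$ and $r(D)=1$. A vertex $x$ is a Weierstrass point of $G$ if $r(g(G)\,(x))\ge 1$. For integers $l_1,l_2,l_3\ge 1$, let $B(l_1,l_2,l_3)$ be the graph consisting of two vertices and three internally disjoint paths of lengths $l_1,l_2,l_3$ joining them; for $n\ge 3$, let $B_n$ be the graph with two vertices joined by $n$ edges.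 For $l\ge 1$, let $\Phi(l)$ be the graph consisting of two disjoint paths $[x_0,\dots,x_l]$ and $[y_0,\dots,y_l]$ of length $l$, together with two parallel edges joining $x_0$ to $y_0$ and two parallel edges joining $x_l$ to $y_l$. Theorem. A graph $G$ is $2$-edge-connected, hyperelliptic, and without Weierstrass points if and only if it is isomorphic to one of the following graphs: 1. $B_n$ for some integer $n\ge 3$; 2. $B(l_1,l_2,l_3)$ for some odd integers $l_1,l_2,l_3\ge 1$; 3. $\Phi(l)$ for some integer $l\ge 1$. -/

import Mathlib

open scoped Graph

namespace Graph

variable {α β α' β' : Type*}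

/-! ### Edge connectivity, genus and isomorphism of multigraphs -/

/-- `G` is `k`-edge-connected: `G - W` is connected (in particular it has a vertex) for every set
`W` of fewer than `k` edges of `G`. -/
def IsEdgeConnected (G : Graph α β) (k : ℕ) : Prop :=
  ∀ W : Set β, W ⊆ E(G) → W.Finite → W.ncard < k → (G.deleteEdges W).toSimpleGraph.Connected

/-- The genus (cyclomatic number) `|E(G)| - |V(G)| + 1`. -/
noncomputable def genus (G : Graph α β) : ℤ :=
  (E(G).ncard : ℤ) - (V(G).ncard : ℤ) + 1

/-- Two multigraphs are isomorphic: there are bijections between the vertices and between the edges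
that preserve incidence. -/
def IsIsomorphic (G : Graph α β) (H : Graph α' β') : Prop :=
  ∃ (φ : V(G) ≃ V(H)) (ψ : E(G) ≃ E(H)),
    ∀ (e : E(G)) (x y : V(G)), G.IsLink e x y ↔ H.IsLink (ψ e) (φ x) (φ y)

/-! ### Divisors -/

/-- The group of divisors on (the finite graph) `G`: integer-valued functions on the vertices.
The order is the pointwise one, so that `D` is effective when `0 ≤ D`. -/
abbrev Divisor (G : Graph α β) : Type _ := V(G) → ℤ

namespace Divisor

variable {G : Graph α β}

open Classical in
/-- The divisor `(x)` of a single vertex `x`. -/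
noncomputable def point (x : V(G)) : Divisor G := fun y => if y = x then 1 else 0

variable [Fintype V(G)]

/-- The degree of a divisor. -/
def degree (D : Divisor G) : ℤ := ∑ x, D x

/-- The divisor of the function `f`: its coefficient at `x` is the sum of `f x - f y` over all edges
`e = xy` at `x`; here the edges are grouped by their other end `y`. -/
noncomputable def principal (f : V(G) → ℤ) : Divisor G :=
  fun x => ∑ y : V(G), ({e | G.IsLink e x y}.ncard : ℤ) * (f x - f y)

/-- Two divisors are linearly equivalent if their difference is principal. -/
def LinearEquivalent (D D' : Divisor G) : Prop :=
  ∃ f : V(G) → ℤ, D - D' = principal f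

/-- The complete linear system `|D|`: all effective divisors that are linearly equivalent to `D`. -/
def linearSystem (D : Divisor G) : Set (Divisor G) :=
  {E | 0 ≤ E ∧ LinearEquivalent E D}

/-- The integers `k` such that `|D - E|` is non-empty for all effective divisors `E` of
degree `k`. -/
def rankSet (D : Divisor G) : Set ℤ :=
  {k | ∀ E : Divisor G, 0 ≤ E → degree E = k → (linearSystem (D - E)).Nonempty}

open Classical in
/-- The rank `r(D)`: it is `-1` if `|D|` is empty, and otherwise the largest integer `k` such that
`|D - E|` is non-empty for all effective divisors `E` of degree `k`. -/
noncomputable def rank (D : Divisor G) : ℤ :=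
  if (linearSystem D).Nonempty then sSup (rankSet D) else -1

/-- A principal divisor has degree zero. -/
theorem degree_principal (f : V(G) → ℤ) : degree (principal f) = 0 := by
  have h : degree (principal f) = -degree (principal f) := by
    unfold degree principal
    conv_lhs => rw [Finset.sum_comm]
    rw [← Finset.sum_neg_distrib]
    refine Finset.sum_congr rfl fun x _ => ?_
    rw [← Finset.sum_neg_distrib]
    refine Finset.sum_congr rfl fun y _ => ?_
    have hxy : {e | G.IsLink e (y : α) (x : α)} = {e | G.IsLink e (x : α) (y : α)} := by
      ext e
      exact G.isLink_comm
    rw [hxy]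
    ring
  omega

/-- The maximum in the definition of the rank exists. -/
theorem isGreatest_rank [Nonempty V(G)] (D : Divisor G) (hD : (linearSystem D).Nonempty) :
    IsGreatest (rankSet D) (rank D) := by
  have hne : (rankSet D).Nonempty := by
    refine ⟨0, fun E hE hdeg => ?_⟩
    have hzero : E = 0 := by
      funext x
      exact (Finset.sum_eq_zero_iff_of_nonneg (fun i _ => hE i)).1 hdeg x (Finset.mem_univ x)
    simpa [hzero] using hD
  have hbdd : BddAbove (rankSet D) := by
    refine ⟨max 0 (degree D), fun k hk => ?_⟩
    by_contra hlt
    obtain ⟨h0, h1⟩ := max_lt_iff.1 (not_le.1 hlt)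
    obtain ⟨x⟩ := ‹Nonempty V(G)›
    have hpt : degree (k • point x) = k := by simp [degree, point]
    have hnn : (0 : Divisor G) ≤ k • point x := by
      intro y
      by_cases hy : y = x <;> simp [point, hy, h0.le]
    obtain ⟨F, hF, f, hf⟩ := hk _ hnn hpt
    have hdeg : degree F - (degree D - k) = 0 := by
      rw [← degree_principal f, ← hf]
      simp only [degree, Pi.sub_apply, Finset.sum_sub_distrib] at hpt ⊢
      rw [hpt]
    have hF0 : 0 ≤ degree F := Finset.sum_nonneg fun i _ => hF i
    omega
  rw [rank, if_pos hD]
  exact ⟨Int.csSup_mem hne hbdd, fun k hk => le_csSup hbdd hk⟩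

end Divisor

/-! ### Hyperelliptic graphs and Weierstrass points -/

/-- A graph is hyperelliptic if its genus is at least `2` and it has a divisor of degree `2` and
rank `1`. -/
def IsHyperelliptic (G : Graph α β) [Fintype V(G)] : Prop :=
  2 ≤ G.genus ∧ ∃ D : Divisor G, D.degree = 2 ∧ D.rank = 1

/-- A vertex `x` is a Weierstrass point if `r(g(x)) ≥ 1`, where `g` is the genus. -/
def IsWeierstrassPoint (G : Graph α β) [Fintype V(G)] (x : V(G)) : Prop :=
  1 ≤ Divisor.rank (G.genus • Divisor.point x)

/-! ### The three families -/

/-- The multigraph whose vertices and edges are all the elements of two given types, the edge `e`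
joining the two members of `ends e`. -/
def ofEnds (ends : β → α × α) : Graph α β where
  vertexSet := Set.univ
  edgeSet := Set.univ
  IsLink e x y := s(x, y) = s((ends e).1, (ends e).2)
  isLink_symm e _ := ⟨fun x y h => by rw [Sym2.eq_swap]; exact h⟩
  eq_or_eq_of_isLink_of_isLink e x y v w h h' := by
    have := h.trans h'.symm
    rw [Sym2.eq_iff] at this
    tauto
  edge_mem_iff_exists_isLink e :=
    ⟨fun _ => ⟨(ends e).1, (ends e).2, rfl⟩, fun _ => Set.mem_univ e⟩
  left_mem_of_isLink _ x _ _ := Set.mem_univ x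

/-- The graph `B_n`: two vertices joined by `n` edges. -/
def bananaGraph (n : ℕ) : Graph Bool (Fin n) := banana false true Set.univ

/-- The vertex at distance `i` from the first vertex on the path with index `j` in the graph
`B(l_1, …, l_n)`: the common first vertex for `i = 0`, the common last vertex for `i = l j`, and an
internal vertex of that path, numbered by `i - 1`, otherwise. -/
def pathsVertex {n : ℕ} (l : Fin n → ℕ) (j : Fin n) (i : Fin (l j + 1)) :
    Bool ⊕ (Σ j : Fin n, Fin (l j - 1)) :=
  if h₀ : (i : ℕ) = 0 then Sum.inl false
  else if h₁ : (i : ℕ) = l j then Sum.inl true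
  else Sum.inr ⟨j, ⟨i - 1, by omega⟩⟩

/-- The graph `B(l_1, …, l_n)` for positive integers `l_j`: two vertices and `n` internally disjoint
paths between them, of lengths `l_1, …, l_n`. The edge `⟨j, i⟩` joins the vertices number `i` and
`i + 1` of the path with index `j`. -/
def pathsGraph {n : ℕ} (l : Fin n → ℕ) :
    Graph (Bool ⊕ (Σ j : Fin n, Fin (l j - 1))) (Σ j : Fin n, Fin (l j)) :=
  ofEnds fun e => (pathsVertex l e.1 e.2.castSucc, pathsVertex l e.1 e.2.succ)

/-- The graph `Φ(l)`: two disjoint paths of length `l`, namely `x_i = (false, i)` and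
`y_i = (true, i)` for `0 ≤ i ≤ l`, together with two parallel edges joining `x_0` to `y_0` and two
parallel edges joining `x_l` to `y_l`. The edge `inl (b, i)` is the edge number `i` of the path `b`;
the edges `inr (b, c)` for the two values of `c` are the parallel ones at the end `b`. -/
def phiGraph (l : ℕ) : Graph (Bool × Fin (l + 1)) ((Bool × Fin l) ⊕ (Bool × Bool)) :=
  ofEnds fun
    | Sum.inl (b, i) => ((b, i.castSucc), (b, i.succ))
    | Sum.inr (false, _) => ((false, 0), (true, 0))
    | Sum.inr (true, _) => ((false, Fin.last l), (true, Fin.last l))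

end Graph

/-!
Let `D` have degree two and rank one on a `2`-edge-connected graph `G` of genus `g ≥ 2`. Distinct
vertices of `G` are not equivalent, so every vertex `x` has a unique partner `ι x` with
`x + ι x ∼ D`. If `ι x = x`, then `g x ∼ D + (g - 2) x` has rank at least one; hence without
Weierstrass points `ι` is an involution without fixed points (`exists_hyperellipticInvolution`).

The key fact on linear equivalence is that the set where a function is minimal can be fired without
debt (`exists_firing_set`). Applied to `x + ι x ∼ y + ι y` for an edge `x y` with `y ≠ ι x`, it shows
that this edge and its image form a cut (`IsHyperellipticInvolution.exists_cut`). So `G` consists of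
two copies of a tree, swapped by `ι`, and of further vertical edges joining some `x` to `ι x`
(`IsDoubleTree`). Such a graph is handled by rooting it at a pair `{a, ι a}`: each other vertex has
a unique parent (`IsDoubleTree.parent_or_parent`), and its degree is the number of its vertical
edges, plus one, plus the number of its children (`IsDoubleTree.deg_eq`).

If `x` has a vertical edge and degree less than `g`, then firing `x` turns `g x` into an effective
divisor that contains `x + ι x`, so `x` is a Weierstrass point. Hence all vertices with vertical
edges, in particular the leaves of the tree, have degree at least `g`. As the numbers `deg x - 2` are
non-negative with sum `2 g - 2`, two pairs of leaves force `g ≤ 3`. If the tree is a single vertex,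
then `G` is a banana graph. Otherwise, for `g = 2` there is one pair of trivalent vertices and there
are three vertical edges; the paths from these to the root give a graph `B(l₁, l₂, l₃)` with odd
lengths. For `g = 3` the tree is a path with two vertical edges at both ends, so `G` is some `Φ(l)`.

Conversely, firing a vertex of degree two shows that the vertex classes along each path of
`B(l₁, l₂, l₃)` or `Φ(l)` form an arithmetic progression (`eq_add_nsmul_of_mean`). This gives the
divisor of degree two and rank one, and it rewrites a suitable `g x - v` as a divisor in which firing
any set creates a debt, so that it is not equivalent to an effective divisor. For `B(l₁, l₂, l₃)`
with trivalent vertices `a`, `b` this divisor is `2 a - w` with `w ≠ a`; for `Φ(l)` it is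
`x_0 + x_i + x_l - y_w`; for the banana graph on `x` and `v` it is `g x - v` itself.
-/

set_option linter.unusedSectionVars false

namespace Multiplicity

variable {V : Type*} [Fintype V] [DecidableEq V] {μ : V → V → ℕ} {ι : V → V}

/-! ### The Laplacian of a multiplicity function -/

/-- The Laplacian of the multigraph on `V` with `μ x y` edges between `x` and `y`. -/
def lap (μ : V → V → ℕ) : (V → ℤ) →+ (V → ℤ) where
  toFun f x := ∑ y, (μ x y : ℤ) * (f x - f y)
  map_zero' := by ext; simp
  map_add' f g := by
    ext x
    simp only [Pi.add_apply, ← Finset.sum_add_distrib]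
    exact Finset.sum_congr rfl fun y _ => by ring

theorem lap_apply (f : V → ℤ) (x : V) : lap μ f x = ∑ y, (μ x y : ℤ) * (f x - f y) := rfl

/-- The group of principal divisors. -/
def principal (μ : V → V → ℕ) : AddSubgroup (V → ℤ) := (lap μ).range

/-- The number of edges from `x` to vertices outside `S`. -/
def outdeg (μ : V → V → ℕ) (S : Finset V) (x : V) : ℕ := ∑ y ∈ Sᶜ, μ x y

/-- The number of edges at `x`. -/
def deg (μ : V → V → ℕ) (x : V) : ℕ := ∑ y, μ x y

/-- The divisor of a vertex. -/
def pt (x : V) : V → ℤ := Pi.single x 1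

theorem pt_apply (x y : V) : pt x y = if y = x then 1 else 0 := by
  simp [pt, Pi.single_apply]

theorem pt_nonneg (x : V) : 0 ≤ pt x := fun y => by
  rw [pt_apply]; split_ifs <;> simp

theorem exists_eq_pt {D : V → ℤ} (h0 : 0 ≤ D) (h1 : ∑ x, D x = 1) : ∃ x, D = pt x := by
  have hex : ∃ x, 0 < D x := by
    by_contra! h
    have : ∑ x, D x ≤ 0 := Finset.sum_nonpos fun x _ => h x
    omega
  obtain ⟨x, hx⟩ := hex
  refine ⟨x, ?_⟩
  have hsum := Finset.add_sum_erase Finset.univ D (Finset.mem_univ x)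
  have hn : 0 ≤ ∑ y ∈ Finset.univ.erase x, D y := Finset.sum_nonneg fun y _ => h0 y
  have hz : ∑ y ∈ Finset.univ.erase x, D y = 0 := by omega
  rw [Finset.sum_eq_zero_iff_of_nonneg fun y _ => h0 y] at hz
  ext y
  rw [pt_apply]
  split_ifs with hy
  · subst hy; omega
  · exact hz y (by simp [hy])

theorem sum_pt (S : Finset V) (x : V) : ∑ y ∈ S, pt x y = if x ∈ S then 1 else 0 := by
  simp [pt_apply]

/-- The set where `f` is minimal: adding the divisor of `f` takes from each of its vertices at least
the chips that firing the set would take. -/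
theorem exists_firing_set [Nonempty V] (f : V → ℤ) :
    ∃ S : Finset V, S.Nonempty ∧ (∀ x ∈ S, lap μ f x ≤ -(outdeg μ S x : ℤ)) ∧
      (S = Finset.univ → lap μ f = 0) := by
  obtain ⟨m, hm⟩ := Finite.exists_min f
  refine ⟨Finset.univ.filter fun x => f x = f m, ⟨m, by simp⟩, fun x hx => ?_, fun h => ?_⟩
  · have hx' : f x = f m := by simpa using hx
    rw [lap_apply, ← Finset.sum_add_sum_compl (Finset.univ.filter fun x => f x = f m)]
    have h1 : ∑ y ∈ Finset.univ.filter (fun x => f x = f m), (μ x y : ℤ) * (f x - f y) = 0 :=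
      Finset.sum_eq_zero fun y hy => by
        have : f y = f m := by simpa using hy
        rw [hx', this, sub_self, mul_zero]
    rw [h1, zero_add, outdeg, Nat.cast_sum, ← Finset.sum_neg_distrib]
    refine Finset.sum_le_sum fun y hy => ?_
    have hy' : f y ≠ f m := by simpa using hy
    have := lt_of_le_of_ne (hm y) hy'.symm
    nlinarith [Int.natCast_nonneg (μ x y)]
  · have h' : ∀ x, f x = f m := fun x => by
      have hx := Finset.mem_univ x
      rw [← h] at hx
      simpa using hx
    ext x
    simp [lap_apply, h']

/-- If `D` is equivalent to an effective divisor, then some non-empty set of vertices can be fired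
without any of its vertices going into debt. -/
theorem exists_legal_set [Nonempty V] {D E : V → ℤ} (hE : 0 ≤ E) (h : E - D ∈ principal μ) :
    ∃ S : Finset V, S.Nonempty ∧ ∀ x ∈ S, (outdeg μ S x : ℤ) ≤ D x := by
  obtain ⟨f, hf⟩ := h
  obtain ⟨S, hS, hle, -⟩ := exists_firing_set (μ := μ) f
  refine ⟨S, hS, fun x hx => ?_⟩
  have h1 := hle x hx
  have h2 : lap μ f x = E x - D x := by rw [hf]; rfl
  have h3 : 0 ≤ E x := hE x
  omega

/-- The multigraph with multiplicities `μ` is loopless and `2`-edge-connected; the latter is encoded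
by requiring at least two edges in every cut. -/
structure IsTwoEdgeConnected (μ : V → V → ℕ) : Prop where
  symm : ∀ x y, μ x y = μ y x
  self : ∀ x, μ x x = 0
  cut : ∀ S : Finset V, S.Nonempty → Sᶜ.Nonempty → 2 ≤ ∑ x ∈ S, outdeg μ S x

theorem IsTwoEdgeConnected.eq_univ_of_closed (hμ : IsTwoEdgeConnected μ) {S : Finset V} (hS : S.Nonempty)
    (h : ∀ x ∈ S, ∀ y, 0 < μ x y → y ∈ S) : S = Finset.univ := by
  by_contra hne
  have h2 := hμ.cut S hS (by
    rw [Finset.nonempty_iff_ne_empty, Ne, Finset.compl_eq_empty_iff]; exact hne)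
  have h0 : ∑ x ∈ S, outdeg μ S x = 0 :=
    Finset.sum_eq_zero fun x hx => Finset.sum_eq_zero fun y hy => by
      by_contra hpos
      exact Finset.mem_compl.1 hy (h x hx y (Nat.pos_of_ne_zero hpos))
  omega

theorem IsTwoEdgeConnected.induction (hμ : IsTwoEdgeConnected μ) {p : V → Prop} {a : V} (ha : p a)
    (h : ∀ x y, p x → 0 < μ x y → p y) (x : V) : p x := by
  classical
  have := hμ.eq_univ_of_closed (S := Finset.univ.filter p) ⟨a, by simpa using ha⟩
    (fun x hx y hxy => by
      simp only [Finset.mem_filter, Finset.mem_univ, true_and] at hx ⊢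
      exact h x y hx hxy)
  have hx := Finset.mem_univ x
  rw [← this] at hx
  simpa using hx

theorem IsTwoEdgeConnected.two_le_deg (hμ : IsTwoEdgeConnected μ) {x y : V} (hxy : x ≠ y) :
    2 ≤ deg μ x := by
  have := hμ.cut {x} ⟨x, by simp⟩ ⟨y, by simp [hxy.symm]⟩
  rw [Finset.sum_singleton] at this
  exact this.trans (Finset.sum_le_sum_of_subset (Finset.subset_univ _))

/-- Distinct vertices of a `2`-edge-connected graph are not equivalent. -/
theorem IsTwoEdgeConnected.eq_of_pt_sub_pt_mem (hμ : IsTwoEdgeConnected μ) {x y : V}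
    (h : pt x - pt y ∈ principal μ) : x = y := by
  obtain ⟨f, hf⟩ := h
  have : Nonempty V := ⟨x⟩
  obtain ⟨S, hS, hle, huniv⟩ := exists_firing_set (μ := μ) f
  by_contra hxy
  have hne : S ≠ Finset.univ := fun h => by
    have h1 : pt x - pt y = 0 := by rw [← hf, huniv h]
    have := congrFun h1 x
    simp [pt_apply, hxy] at this
  have h2 := hμ.cut S hS (by
    rw [Finset.nonempty_iff_ne_empty, Ne, Finset.compl_eq_empty_iff]; exact hne)
  have h3 : ∑ z ∈ S, lap μ f z ≤ ∑ z ∈ S, -(outdeg μ S z : ℤ) := Finset.sum_le_sum hle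
  rw [hf] at h3
  simp only [Pi.sub_apply, Finset.sum_sub_distrib, sum_pt, Finset.sum_neg_distrib] at h3
  have h4 : (2 : ℤ) ≤ ∑ x ∈ S, (outdeg μ S x : ℤ) := by exact_mod_cast h2
  split_ifs at h3 <;> omega

/-- Firing a set whose boundary consists of two edges moves one chip along each of them. -/
theorem indicator_mem_principal (hsymm : ∀ x y, μ x y = μ y x) {S : Finset V} {x y x' y' : V}
    (hx : x ∈ S) (hx' : x' ∈ S) (hy : y ∉ S) (hy' : y' ∉ S)
    (h : ∀ u ∈ S, ∀ v ∉ S, (μ u v : ℤ) = pt x u * pt y v + pt x' u * pt y' v) :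
    pt x + pt x' - pt y - pt y' ∈ principal μ := by
  refine ⟨fun z => if z ∈ S then 1 else 0, ?_⟩
  have ne : ∀ {u v : V}, u ∈ S → v ∉ S → v ≠ u := fun hu hv h => hv (h ▸ hu)
  ext u
  rw [lap_apply]
  simp only [Pi.sub_apply, Pi.add_apply]
  by_cases hu : u ∈ S
  · have e1 : ∀ v, (μ u v : ℤ) * ((if u ∈ S then 1 else 0) - (if v ∈ S then 1 else 0)) =
        pt x u * pt y v + pt x' u * pt y' v := fun v => by
      by_cases hv : v ∈ S
      · simp [hu, hv, pt_apply, (ne hv hy).symm, (ne hv hy').symm]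
      · simp [hu, hv, h u hu v hv]
    rw [Finset.sum_congr rfl fun v _ => e1 v, Finset.sum_add_distrib, ← Finset.mul_sum,
      ← Finset.mul_sum, sum_pt, sum_pt]
    simp [pt_apply, (ne hu hy).symm, (ne hu hy').symm]
  · have e1 : ∀ v, (μ u v : ℤ) * ((if u ∈ S then 1 else 0) - (if v ∈ S then 1 else 0)) =
        -(pt x v * pt y u + pt x' v * pt y' u) := fun v => by
      by_cases hv : v ∈ S
      · rw [hsymm]; simp [hu, hv, h v hv u hu]
      · simp [hu, hv, pt_apply, (ne hx hv), (ne hx' hv)]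
    rw [Finset.sum_congr rfl fun v _ => e1 v, Finset.sum_neg_distrib, Finset.sum_add_distrib,
      ← Finset.sum_mul, ← Finset.sum_mul, sum_pt, sum_pt]
    simp only [Finset.mem_univ, if_true, one_mul]
    simp [pt_apply, (ne hx hu), (ne hx' hu)]
    ring

/-- Firing a single vertex. -/
theorem deg_smul_pt_sub_mem (hself : ∀ x, μ x x = 0) (hsymm : ∀ x y, μ x y = μ y x) (x : V) :
    ((deg μ x : ℤ) • pt x - fun y => (μ x y : ℤ)) ∈ principal μ := by
  refine ⟨pt x, ?_⟩
  ext u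
  rw [lap_apply]
  simp only [Pi.sub_apply, Pi.smul_apply, smul_eq_mul, mul_sub, Finset.sum_sub_distrib]
  by_cases hu : u = x
  · subst hu
    simp [pt_apply, hself, deg]
  · simp [pt_apply, hu, hsymm x u]

/-- `ι` is an involution all whose pairs `x + ι x` are equivalent, and it has no fixed points. -/
structure IsHyperellipticInvolution (μ : V → V → ℕ) (ι : V → V) : Prop where
  ne : ∀ x, ι x ≠ x
  mem : ∀ x y, pt x + pt (ι x) - pt y - pt (ι y) ∈ principal μ

namespace IsHyperellipticInvolution

theorem eq_of_mem (hι : IsHyperellipticInvolution μ ι) (hμ : IsTwoEdgeConnected μ) {x y z : V}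
    (h : pt z + pt (ι z) - pt x - pt y ∈ principal μ) : y = ι x := by
  refine hμ.eq_of_pt_sub_pt_mem ?_
  have := (principal μ).sub_mem (hι.mem z x) h
  convert this using 1
  abel

theorem involutive (hι : IsHyperellipticInvolution μ ι) (hμ : IsTwoEdgeConnected μ) (x : V) :
    ι (ι x) = x :=
  (hι.eq_of_mem hμ (z := x) (by
    convert (principal μ).zero_mem using 1
    abel)).symm

/-- An edge `x y` with `y ≠ ι x` forms, together with its image under the involution, a cut that
separates `x` and `ι x` from `y` and `ι y`. -/
theorem exists_cut (hι : IsHyperellipticInvolution μ ι) (hμ : IsTwoEdgeConnected μ) {x y : V}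
    (hxy : 0 < μ x y) (hy : y ≠ ι x) :
    ∃ S : Finset V, x ∈ S ∧ ι x ∈ S ∧ y ∉ S ∧ ι y ∉ S ∧
      ∀ u ∈ S, ∀ v ∉ S, (μ u v : ℤ) = pt x u * pt y v + pt (ι x) u * pt (ι y) v := by
  obtain ⟨f, hf⟩ := hι.mem y x
  have : Nonempty V := ⟨x⟩
  obtain ⟨S, hS, hle, huniv⟩ := exists_firing_set (μ := μ) f
  have hxy' : y ≠ x := by rintro rfl; rw [hμ.self] at hxy; omega
  have hxx := hι.ne x
  have hyy := hι.ne y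
  have hy' : ι y ≠ x := fun h => hy (by rw [← h, hι.involutive hμ])
  have hyx' : ι y ≠ ι x := fun h => hxy' (by rw [← hι.involutive hμ x, ← h, hι.involutive hμ])
  have hfx : ∀ z, lap μ f z = pt y z + pt (ι y) z - pt x z - pt (ι x) z := fun z => by rw [hf]; rfl
  have hne : S ≠ Finset.univ := fun h => by
    have h1 := hfx x
    rw [huniv h] at h1
    simp [pt_apply, hxy'.symm, hy'.symm, hxx.symm] at h1
  have h2 := hμ.cut S hS (by
    rw [Finset.nonempty_iff_ne_empty, Ne, Finset.compl_eq_empty_iff]; exact hne)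
  have h3 : ∑ z ∈ S, lap μ f z ≤ ∑ z ∈ S, -(outdeg μ S z : ℤ) := Finset.sum_le_sum hle
  simp only [hfx, Finset.sum_add_distrib, Finset.sum_sub_distrib, sum_pt,
    Finset.sum_neg_distrib] at h3
  have h4 : (2 : ℤ) ≤ ∑ x ∈ S, (outdeg μ S x : ℤ) := by exact_mod_cast h2
  have hmem : x ∈ S ∧ ι x ∈ S ∧ y ∉ S ∧ ι y ∉ S := by
    split_ifs at h3 <;> first | omega | (refine ⟨?_, ?_, ?_, ?_⟩ <;> assumption)
  obtain ⟨hxS, hιxS, hyS, hιyS⟩ := hmem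
  have hout : ∀ z ∈ S, (outdeg μ S z : ℤ) ≤ pt x z + pt (ι x) z := fun z hz => by
    have h5 := hle z hz
    rw [hfx] at h5
    have := pt_nonneg y z
    have := pt_nonneg (ι y) z
    simp only [Pi.zero_apply] at *
    omega
  -- the two boundary edges are accounted for by one edge at `x` and one edge at `ι x`
  have hsum : ∑ z ∈ S, (outdeg μ S z : ℤ) = 2 := by
    refine le_antisymm ((Finset.sum_le_sum hout).trans ?_) h4
    simp [Finset.sum_add_distrib, sum_pt, hxS, hιxS]
  have hout' : ∀ z ∈ S, (outdeg μ S z : ℤ) = pt x z + pt (ι x) z := by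
    refine (Finset.sum_eq_sum_iff_of_le hout).1 ?_
    rw [hsum]
    simp [Finset.sum_add_distrib, sum_pt, hxS, hιxS]
  have hunique : ∀ z w, outdeg μ S z = 1 → w ∉ S → 0 < μ z w → ∀ v ∉ S, (μ z v : ℤ) = pt w v := by
    intro z w hz hw hpos v hv
    have h6 := Finset.add_sum_erase Sᶜ (μ z) (Finset.mem_compl.2 hw)
    rw [outdeg] at hz
    rw [pt_apply]
    split_ifs with hvw
    · subst hvw; omega
    · have h7 := Finset.single_le_sum (f := μ z) (fun _ _ => Nat.zero_le _)
        (Finset.mem_erase.2 ⟨hvw, Finset.mem_compl.2 hv⟩)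
      omega
  have hox : outdeg μ S x = 1 := by
    have := hout' x hxS
    simp [pt_apply, hxx.symm] at this
    exact this
  have hoιx : outdeg μ S (ι x) = 1 := by
    have := hout' _ hιxS
    simp [pt_apply, hxx] at this
    exact this
  obtain ⟨w, hwS, hw⟩ : ∃ w, w ∉ S ∧ 0 < μ (ι x) w := by
    by_contra! h
    have : outdeg μ S (ι x) = 0 := Finset.sum_eq_zero fun v hv =>
      Nat.le_zero.1 (h v (Finset.mem_compl.1 hv))
    omega
  have hform : ∀ u ∈ S, ∀ v ∉ S, (μ u v : ℤ) = pt x u * pt y v + pt (ι x) u * pt w v := by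
    intro u hu v hv
    by_cases h1 : u = x
    · subst h1
      simp [hunique u y hox hyS hxy v hv, pt_apply, hxx.symm]
    by_cases h2 : u = ι x
    · subst h2
      simp [hunique _ w hoιx hwS hw v hv, pt_apply, hxx]
    have h3 := hout' u hu
    simp only [pt_apply, h1, h2, if_false, add_zero, Nat.cast_eq_zero, outdeg] at h3
    rw [Finset.sum_eq_zero_iff] at h3
    simp [h3 v (Finset.mem_compl.2 hv), pt_apply, h1, h2]
  have hwy : w = ι y := hι.eq_of_mem hμ (z := x)
    (indicator_mem_principal hμ.symm hxS hιxS hyS hwS hform)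
  exact ⟨S, hxS, hιxS, hyS, hιyS, hwy ▸ hform⟩

end IsHyperellipticInvolution

/-- A multigraph that is a doubled tree: `ι` is an automorphism without fixed points, and each edge
that does not join some `x` to `ι x` forms, together with its image, a cut. -/
structure IsDoubleTree (μ : V → V → ℕ) (ι : V → V) : Prop where
  symm : ∀ x y, μ x y = μ y x
  self : ∀ x, μ x x = 0
  induction : ∀ {p : V → Prop} {a : V}, p a → (∀ x y, p x → 0 < μ x y → p y) → ∀ x, p x
  involutive : ∀ x, ι (ι x) = x
  ne : ∀ x, ι x ≠ x
  map : ∀ x y, μ (ι x) (ι y) = μ x y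
  eq_one : ∀ x y, 0 < μ x y → y ≠ ι x → μ x y = 1
  exists_cut : ∀ x y, 0 < μ x y → y ≠ ι x → ∃ S : Finset V, (∀ z, ι z ∈ S ↔ z ∈ S) ∧ x ∈ S ∧ y ∉ S ∧
    ∀ u ∈ S, ∀ v ∉ S, 0 < μ u v → (u = x ∧ v = y) ∨ (u = ι x ∧ v = ι y)

theorem IsHyperellipticInvolution.isDoubleTree (hι : IsHyperellipticInvolution μ ι)
    (hμ : IsTwoEdgeConnected μ) : IsDoubleTree μ ι := by
  have hinv := hι.involutive hμ
  have hinj : ∀ {x y}, ι x = ι y → x = y := fun {x y} h => by rw [← hinv x, h, hinv]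
  have hone : ∀ x y, 0 < μ x y → y ≠ ι x → μ x y = 1 ∧ μ (ι x) (ι y) = 1 := by
    intro x y hxy hy
    obtain ⟨S, hx, hx', hy', hy'', h⟩ := hι.exists_cut hμ hxy hy
    have h1 := h x hx y hy'
    have h2 := h _ hx' _ hy''
    simp [pt_apply, (hι.ne x).symm] at h1
    simp [pt_apply, hι.ne x] at h2
    exact ⟨h1, h2⟩
  have hmap : ∀ x y, μ (ι x) (ι y) = μ x y := by
    intro x y
    by_cases hy : y = ι x
    · subst hy; rw [hinv, hμ.symm]
    rcases Nat.eq_zero_or_pos (μ x y) with h0 | hpos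
    · rcases Nat.eq_zero_or_pos (μ (ι x) (ι y)) with h0' | hpos'
      · omega
      · have := (hone _ _ hpos' fun h => hy (hinj h)).2
        rw [hinv, hinv] at this
        omega
    · have := hone x y hpos hy
      omega
  refine ⟨hμ.symm, hμ.self, hμ.induction, hinv, hι.ne, hmap, fun x y h h' => (hone x y h h').1, ?_⟩
  intro x y hxy hy
  obtain ⟨S, hx, hx', hy', hy'', h⟩ := hι.exists_cut hμ hxy hy
  have hb : ∀ u ∈ S, ∀ v ∉ S, 0 < μ u v → (u = x ∧ v = y) ∨ (u = ι x ∧ v = ι y) := by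
    intro u hu v hv hpos
    have h1 := h u hu v hv
    by_contra hcon
    rw [not_or] at hcon
    have e1 : pt x u * pt y v = 0 := by
      rcases not_and_or.1 hcon.1 with h | h <;> simp [pt_apply, h]
    have e2 : pt (ι x) u * pt (ι y) v = 0 := by
      rcases not_and_or.1 hcon.2 with h | h <;> simp [pt_apply, h]
    omega
  refine ⟨S, ?_, hx, hy', hb⟩
  -- the boundary of `S` is invariant, so `ι z ∈ S ↔ z ∈ S` propagates along edges
  refine hμ.induction (p := fun z => ι z ∈ S ↔ z ∈ S) (a := x) (by simp [hx, hx']) ?_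
  intro u v huv hpos
  have key : ∀ u v, 0 < μ u v → u ∈ S → v ∉ S → ι u ∈ S ∧ ι v ∉ S := by
    intro u v hpos hu hv
    rcases hb u hu v hv hpos with ⟨rfl, rfl⟩ | ⟨rfl, rfl⟩
    · exact ⟨hx', hy''⟩
    · rw [hinv, hinv]; exact ⟨hx, hy'⟩
  have hpos' : 0 < μ v u := by rwa [hμ.symm]
  have k1 := key u v hpos
  have k2 := key v u hpos'
  have k3 := key (ι u) (ι v) (by rwa [hmap])
  have k4 := key (ι v) (ι u) (by rwa [hmap])
  rw [hinv, hinv] at k3 k4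
  tauto

/-! ### Depth and parents in a doubled tree -/

/-- There is a walk of length `n` from the pair `{a, ι a}` to the vertex. -/
def Reach (μ : V → V → ℕ) (ι : V → V) (a : V) : ℕ → V → Prop
  | 0, x => x = a ∨ x = ι a
  | n + 1, x => ∃ y, 0 < μ y x ∧ Reach μ ι a n y

/-- The distance from the pair `{a, ι a}`, which is the root of the doubled tree. -/
noncomputable def depth (μ : V → V → ℕ) (ι : V → V) (a x : V) : ℕ := sInf {n | Reach μ ι a n x}

open Classical in
/-- The neighbour of `x` that is nearer to the root `{a, ι a}`; it is `x` itself at the root. -/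
noncomputable def parent (μ : V → V → ℕ) (ι : V → V) (a x : V) : V :=
  if h : ∃ y, 0 < μ y x ∧ depth μ ι a y + 1 = depth μ ι a x then h.choose else x

open Classical in
/-- The number of vertices whose parent is `x`. -/
noncomputable def kids (μ : V → V → ℕ) (ι : V → V) (a x : V) : ℕ :=
  (Finset.univ.filter fun y => depth μ ι a y ≠ 0 ∧ parent μ ι a y = x).card

namespace IsDoubleTree

variable {a x y : V}

theorem deg_map (h : IsDoubleTree μ ι) (x : V) : deg μ (ι x) = deg μ x := by
  rw [deg, deg, ← Equiv.sum_comp (Function.Involutive.toPerm ι h.involutive)]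
  exact Finset.sum_congr rfl fun y _ => h.map x y

theorem reach_depth (h : IsDoubleTree μ ι) (a x : V) : Reach μ ι a (depth μ ι a x) x := by
  refine Nat.sInf_mem (s := {n | Reach μ ι a n x}) ?_
  exact h.induction (p := fun x => ∃ n, Reach μ ι a n x) (a := a) ⟨0, Or.inl rfl⟩
    (fun x y ⟨n, hn⟩ hxy => ⟨n + 1, x, hxy, hn⟩) x

theorem depth_le {n : ℕ} (hn : Reach μ ι a n x) : depth μ ι a x ≤ n := Nat.sInf_le hn

theorem depth_eq_zero (h : IsDoubleTree μ ι) : depth μ ι a x = 0 ↔ x = a ∨ x = ι a := by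
  refine ⟨fun h0 => ?_, fun h0 => Nat.le_zero.1 (depth_le (n := 0) h0)⟩
  have := h.reach_depth a x
  rwa [h0] at this

theorem depth_self (h : IsDoubleTree μ ι) : depth μ ι a a = 0 := h.depth_eq_zero.2 (Or.inl rfl)

theorem reach_map (h : IsDoubleTree μ ι) {n : ℕ} : ∀ {x}, Reach μ ι a n x → Reach μ ι a n (ι x) := by
  induction n with
  | zero =>
    rintro x (rfl | rfl)
    · exact Or.inr rfl
    · exact Or.inl (h.involutive _)
  | succ n ih =>
    rintro x ⟨y, hy, hr⟩
    exact ⟨ι y, by rwa [h.map], ih hr⟩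

theorem depth_map (h : IsDoubleTree μ ι) (a x : V) : depth μ ι a (ι x) = depth μ ι a x := by
  refine le_antisymm (depth_le (h.reach_map (h.reach_depth a x))) (depth_le ?_)
  have := h.reach_map (h.reach_depth a (ι x))
  rwa [h.involutive] at this

theorem depth_le_succ (h : IsDoubleTree μ ι) (hxy : 0 < μ x y) :
    depth μ ι a y ≤ depth μ ι a x + 1 :=
  depth_le ⟨x, hxy, h.reach_depth a x⟩

theorem exists_parent (h : IsDoubleTree μ ι) (hx : depth μ ι a x ≠ 0) :
    ∃ y, 0 < μ y x ∧ depth μ ι a y + 1 = depth μ ι a x := by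
  obtain ⟨n, hn⟩ := Nat.exists_eq_succ_of_ne_zero hx
  have h1 := h.reach_depth a x
  rw [hn] at h1
  obtain ⟨y, hy, hr⟩ := h1
  have h2 := depth_le hr
  have h3 := h.depth_le_succ (a := a) hy
  exact ⟨y, hy, by omega⟩

theorem parent_spec (h : IsDoubleTree μ ι) (hx : depth μ ι a x ≠ 0) :
    0 < μ (parent μ ι a x) x ∧ depth μ ι a (parent μ ι a x) + 1 = depth μ ι a x := by
  rw [parent, dif_pos (h.exists_parent hx)]
  exact (h.exists_parent hx).choose_spec

/-- A shortest path to the root from inside a set that avoids the root leaves the set through a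
vertex at the depth of `x`, if all boundary vertices of the set have that depth. -/
theorem depth_le_of_cut (h : IsDoubleTree μ ι) {S : Set V} (ha : a ∉ S) (ha' : ι a ∉ S)
    (hS : ∀ u ∈ S, ∀ v ∉ S, 0 < μ u v → depth μ ι a u = depth μ ι a x) {v : V} (hv : v ∈ S) :
    depth μ ι a x ≤ depth μ ι a v := by
  induction hn : depth μ ι a v using Nat.strong_induction_on generalizing v with
  | _ n ih =>
    have hv0 : depth μ ι a v ≠ 0 := fun h0 => by
      rcases h.depth_eq_zero.1 h0 with rfl | rfl <;> contradiction
    obtain ⟨w, hw, hd⟩ := h.exists_parent hv0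
    by_cases hwS : w ∈ S
    · have := ih (depth μ ι a w) (by omega) hwS rfl
      omega
    · have := hS v hv w hwS (by rwa [h.symm])
      omega

/-- In a doubled tree, all neighbours of a vertex but its image and one other vertex are farther from
the root. -/
theorem eq_of_depth_le (h : IsDoubleTree μ ι) (hxy : 0 < μ x y) (hy : y ≠ ι x)
    (hd : depth μ ι a y ≤ depth μ ι a x) {p : V} (hp : 0 < μ p x)
    (hpd : depth μ ι a p + 1 = depth μ ι a x) : y = p := by
  obtain ⟨S, hSι, hxS, hyS, hS⟩ := h.exists_cut x y hxy hy
  by_contra hne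
  by_cases ha : a ∈ S
  · -- all vertices outside `S` are reached through `x` or `ι x`
    obtain ⟨w, hw, hdw⟩ := h.exists_parent (a := a) (x := y) (fun h0 => by
      rcases h.depth_eq_zero.1 h0 with rfl | rfl
      · exact hyS ha
      · exact hyS ((hSι _).2 ha))
    by_cases hwS : w ∈ S
    · rcases hS w hwS y hyS hw with ⟨rfl, -⟩ | ⟨rfl, -⟩
      · omega
      · rw [h.depth_map] at hdw; omega
    · have h2 := h.depth_le_of_cut (S := {v | v ∉ S}) (a := a) (x := y) (by simpa using ha)
        (by simpa [hSι] using ha) (fun u hu v hv hpos => by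
        rcases hS v (by simpa using hv) u hu (by rwa [h.symm]) with ⟨-, rfl⟩ | ⟨-, rfl⟩
        · rfl
        · exact h.depth_map _ _) (v := w) hwS
      omega
  · have hpS : p ∈ S := by
      by_contra hpS
      rcases hS x hxS p hpS (by rwa [h.symm]) with ⟨-, rfl⟩ | ⟨h1, -⟩
      · exact hne rfl
      · exact h.ne x h1.symm
    have h1 := h.depth_le_of_cut (S := {v | v ∈ S}) (a := a) (x := x) ha
      (fun h1 => ha ((hSι a).1 h1)) (fun u hu v hv hpos => by
        rcases hS u hu v hv hpos with ⟨rfl, -⟩ | ⟨rfl, -⟩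
        · rfl
        · exact h.depth_map _ _) (v := p) hpS
    omega

theorem eq_parent (h : IsDoubleTree μ ι) (hx : depth μ ι a x ≠ 0) (hxy : 0 < μ x y) (hy : y ≠ ι x)
    (hd : depth μ ι a y ≤ depth μ ι a x) : y = parent μ ι a x :=
  h.eq_of_depth_le hxy hy hd (h.parent_spec hx).1 (h.parent_spec hx).2

theorem parent_ne_map (h : IsDoubleTree μ ι) (hx : depth μ ι a x ≠ 0) : parent μ ι a x ≠ ι x := by
  intro h1
  have := (h.parent_spec hx).2
  rw [h1, h.depth_map] at this
  omega

theorem mult_parent (h : IsDoubleTree μ ι) (hx : depth μ ι a x ≠ 0) : μ x (parent μ ι a x) = 1 :=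
  h.eq_one _ _ (by rw [h.symm]; exact (h.parent_spec hx).1) (h.parent_ne_map hx)

theorem parent_map (h : IsDoubleTree μ ι) (hx : depth μ ι a x ≠ 0) :
    parent μ ι a (ι x) = ι (parent μ ι a x) := by
  refine (h.eq_parent (by rwa [h.depth_map]) ?_ ?_ ?_).symm
  · rw [h.map, h.mult_parent hx]; exact one_pos
  · intro h1
    rw [h.involutive] at h1
    have := (h.parent_spec hx).2
    rw [← h.depth_map, h1] at this
    omega
  · rw [h.depth_map, h.depth_map]
    have := (h.parent_spec hx).2
    omega

/-- Every edge that does not join a vertex to its image joins a vertex to its parent. -/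
theorem parent_or_parent (h : IsDoubleTree μ ι) (a : V) (hxy : 0 < μ x y) (hy : y ≠ ι x) :
    (depth μ ι a x ≠ 0 ∧ y = parent μ ι a x) ∨ (depth μ ι a y ≠ 0 ∧ x = parent μ ι a y) := by
  have key : ∀ x y, 0 < μ x y → y ≠ ι x → depth μ ι a y ≤ depth μ ι a x →
      depth μ ι a x ≠ 0 ∧ y = parent μ ι a x := by
    intro x y hxy hy hd
    have hx : depth μ ι a x ≠ 0 := fun h0 => by
      rw [h0] at hd
      have hne : y ≠ x := by rintro rfl; rw [h.self] at hxy; omega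
      rcases h.depth_eq_zero.1 h0 with rfl | rfl <;>
        rcases h.depth_eq_zero.1 (Nat.le_zero.1 hd) with rfl | rfl
      · exact hne rfl
      · exact hy rfl
      · exact hy (h.involutive _).symm
      · exact hne rfl
    exact ⟨hx, h.eq_parent hx hxy hy hd⟩
  rcases le_total (depth μ ι a y) (depth μ ι a x) with hd | hd
  · exact Or.inl (key x y hxy hy hd)
  · refine Or.inr (key y x (by rwa [h.symm]) (fun h1 => hy ?_) hd)
    rw [h1, h.involutive]

theorem depth_iterate (h : IsDoubleTree μ ι) {i : ℕ} (hi : i ≤ depth μ ι a x) :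
    depth μ ι a ((parent μ ι a)^[i] x) = depth μ ι a x - i := by
  induction i with
  | zero => rfl
  | succ i ih =>
    have h1 := ih (by omega)
    have h2 := (h.parent_spec (a := a) (x := (parent μ ι a)^[i] x) (by omega)).2
    rw [Function.iterate_succ_apply']
    omega

theorem iterate_map (h : IsDoubleTree μ ι) {i : ℕ} (hi : i ≤ depth μ ι a x) :
    (parent μ ι a)^[i] (ι x) = ι ((parent μ ι a)^[i] x) := by
  induction i with
  | zero => rfl
  | succ i ih =>
    rw [Function.iterate_succ_apply', Function.iterate_succ_apply', ih (by omega), h.parent_map]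
    rw [h.depth_iterate (by omega)]
    omega

/-- One of `x` and `ι x` lies in the copy of the tree that contains `a`. -/
theorem iterate_depth (h : IsDoubleTree μ ι) (a x : V) :
    (parent μ ι a)^[depth μ ι a x] x = a ∨ (parent μ ι a)^[depth μ ι a x] x = ι a := by
  refine h.depth_eq_zero.1 ?_
  rw [h.depth_iterate le_rfl, Nat.sub_self]

theorem deg_eq (h : IsDoubleTree μ ι) (a x : V) :
    deg μ x = μ x (ι x) + (if depth μ ι a x = 0 then 0 else 1) + kids μ ι a x := by
  classical
  have key : ∀ y, μ x y = (if y = ι x then μ x (ι x) else 0) +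
      (if y = parent μ ι a x then (if depth μ ι a x = 0 then 0 else 1) else 0) +
      (if depth μ ι a y ≠ 0 ∧ parent μ ι a y = x then 1 else 0) := by
    intro y
    have hk : ∀ {x y}, depth μ ι a y ≠ 0 ∧ parent μ ι a y = x →
        depth μ ι a x + 1 = depth μ ι a y ∧ μ x y = 1 := by
      rintro x y ⟨h0, rfl⟩
      exact ⟨(h.parent_spec h0).2, by rw [h.symm]; exact h.mult_parent h0⟩
    by_cases hy : y = ι x
    · subst hy
      have h1 : ¬ (depth μ ι a (ι x) ≠ 0 ∧ parent μ ι a (ι x) = x) := fun hc => by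
        have := (hk hc).1
        rw [h.depth_map] at this
        omega
      rw [if_pos rfl, if_neg h1]
      by_cases h0 : depth μ ι a x = 0
      · simp [h0]
      · rw [if_neg (h.parent_ne_map h0).symm, add_zero, add_zero]
    rw [if_neg hy, zero_add]
    by_cases hc : depth μ ι a y ≠ 0 ∧ parent μ ι a y = x
    · rw [if_pos hc, (hk hc).2]
      by_cases h0 : depth μ ι a x = 0
      · simp [h0]
      · rw [if_neg]
        rintro rfl
        have h2 := (h.parent_spec h0).2
        have h3 := (hk hc).1
        omega
    rw [if_neg hc, add_zero]
    by_cases h0 : depth μ ι a x = 0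
    · rw [if_pos h0, ite_self]
      by_contra hpos
      rcases h.parent_or_parent a (Nat.pos_of_ne_zero hpos) hy with h1 | h1
      · exact h1.1 h0
      · exact hc ⟨h1.1, h1.2.symm⟩
    · rw [if_neg h0]
      split_ifs with h1
      · rw [h1, h.mult_parent h0]
      · by_contra hpos
        rcases h.parent_or_parent a (Nat.pos_of_ne_zero hpos) hy with h2 | h2
        · exact h1 h2.2
        · exact hc ⟨h2.1, h2.2.symm⟩
  rw [deg, Finset.sum_congr rfl fun y _ => key y, Finset.sum_add_distrib, Finset.sum_add_distrib]
  simp [kids]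

/-- A vertex at maximal depth has no children. -/
theorem exists_kids_eq_zero (h : IsDoubleTree μ ι) (a : V) :
    ∃ x, kids μ ι a x = 0 ∧ ∀ y, depth μ ι a y ≤ depth μ ι a x := by
  have : Nonempty V := ⟨a⟩
  obtain ⟨x, hx⟩ := Finite.exists_max (depth μ ι a)
  refine ⟨x, ?_, hx⟩
  rw [kids, Finset.card_eq_zero, Finset.filter_eq_empty_iff]
  rintro y - ⟨h0, rfl⟩
  have := (h.parent_spec h0).2
  have := hx y
  omega

theorem eq_of_parent_eq (hz : kids μ ι a (parent μ ι a x) ≤ 1) (hx : depth μ ι a x ≠ 0)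
    (hy : depth μ ι a y ≠ 0) (hxy : parent μ ι a x = parent μ ι a y) : x = y := by
  rw [kids, Finset.card_le_one] at hz
  exact hz x (by simp [hx]) y (by simp [hy, hxy])

/-- If there is no branching outside the root, then the paths from two leaves towards the root stay
disjoint until they reach the root. -/
theorem eq_of_iterate_eq (h : IsDoubleTree μ ι) (hk : ∀ z, depth μ ι a z ≠ 0 → kids μ ι a z ≤ 1)
    (hx : kids μ ι a x = 0) (hy : kids μ ι a y = 0) {i j : ℕ} (hi : i < depth μ ι a x)
    (hj : j < depth μ ι a y) (hij : (parent μ ι a)^[i] x = (parent μ ι a)^[j] y) :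
    x = y ∧ i = j := by
  have hleaf : ∀ {x y : V} {j : ℕ}, kids μ ι a x = 0 → j + 1 < depth μ ι a y →
      x ≠ (parent μ ι a)^[j + 1] y := by
    intro x y j hx hj hxy
    rw [kids, Finset.card_eq_zero, Finset.filter_eq_empty_iff] at hx
    refine hx (Finset.mem_univ ((parent μ ι a)^[j] y)) ⟨?_, ?_⟩
    · rw [h.depth_iterate (by omega)]; omega
    · rw [hxy, Function.iterate_succ_apply']
  induction i generalizing j with
  | zero =>
    cases j with
    | zero => exact ⟨hij, rfl⟩
    | succ j => exact absurd hij (hleaf hx hj)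
  | succ i ih =>
    cases j with
    | zero => exact absurd hij.symm (hleaf hy hi)
    | succ j =>
      have hd := h.depth_iterate (a := a) (x := x) hi.le
      have hdi := h.depth_iterate (a := a) (x := x) (i := i) (by omega)
      have hdj := h.depth_iterate (a := a) (x := y) (i := j) (by omega)
      rw [Function.iterate_succ_apply'] at hij hd
      rw [Function.iterate_succ_apply'] at hij
      have := ih (by omega) (j := j) (by omega)
        (eq_of_parent_eq (hk _ (by omega)) (by omega) (by omega) hij)
      exact ⟨this.1, by omega⟩

end IsDoubleTree

end Multiplicity

namespace Graph

open Multiplicity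

variable {α β : Type*} {G : Graph α β}

/-! ### Edges, degrees and connectivity of a multigraph -/

/-- The number of edges joining two vertices. -/
noncomputable def mult (G : Graph α β) (x y : V(G)) : ℕ := {e | G.IsLink e x y}.ncard

theorem mult_comm (x y : V(G)) : G.mult x y = G.mult y x := by
  rw [mult, mult]
  congr 1
  ext e
  exact G.isLink_comm

theorem mult_self [G.Loopless] (x : V(G)) : G.mult x x = 0 := by
  rw [mult]
  convert Set.ncard_empty β
  ext e
  simp only [Set.mem_ofPred_eq, Set.mem_empty_iff_false, iff_false]
  exact fun h => h.adj.ne rfl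

theorem finite_setOf_isLink [Finite E(G)] (x y : α) : {e | G.IsLink e x y}.Finite :=
  Set.Finite.subset (Set.toFinite E(G)) fun _ h => h.edge_mem

theorem mult_pos_iff [Finite E(G)] {x y : V(G)} : 0 < G.mult x y ↔ ∃ e, G.IsLink e x y := by
  rw [mult, Set.ncard_pos (finite_setOf_isLink _ _)]
  rfl

theorem mult_eq_sum [Fintype E(G)] (x y : V(G)) [∀ e : E(G), Decidable (G.IsLink e x y)] :
    G.mult x y = ∑ e : E(G), if G.IsLink e x y then 1 else 0 := by
  rw [Finset.sum_boole, Nat.cast_id, mult,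
    ← Set.ncard_coe_finset, ← Set.ncard_image_of_injective _ Subtype.val_injective]
  congr 1
  ext e
  simp only [Set.mem_ofPred_eq, Finset.coe_filter, Finset.mem_univ, true_and, Set.mem_image,
    Subtype.exists, exists_and_right, exists_eq_right]
  exact ⟨fun h => ⟨h.edge_mem, h⟩, fun h => h.2⟩

theorem deg_eq_ncard [Fintype V(G)] [Finite E(G)] (x : V(G)) :
    deg G.mult x = {e : E(G) | G.Inc e x}.ncard := by
  classical
  have := Fintype.ofFinite E(G)
  rw [deg, Finset.sum_congr rfl fun y _ => mult_eq_sum x y, Finset.sum_comm,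
    Set.ncard_eq_toFinset_card', Finset.card_eq_sum_ones, Set.toFinset_ofPred, Finset.sum_filter]
  refine Finset.sum_congr rfl fun e _ => ?_
  split_ifs with h
  · obtain ⟨y, hy⟩ := h
    rw [Finset.sum_eq_single ⟨y, hy.right_mem⟩, if_pos hy]
    · rintro z - hz
      rw [if_neg]
      exact fun h' => hz (Subtype.ext (h'.right_unique hy))
    · simp
  · exact Finset.sum_eq_zero fun y _ => if_neg fun h' => h h'.inc_left

/-- The handshake lemma. -/
theorem sum_deg [Fintype V(G)] [Finite E(G)] [G.Loopless] :
    ∑ x, deg G.mult x = 2 * E(G).ncard := by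
  classical
  have := Fintype.ofFinite E(G)
  have h1 : ∀ x : V(G), deg G.mult x = ∑ e : E(G), if G.Inc e x then 1 else 0 := fun x => by
    rw [deg_eq_ncard, Set.ncard_eq_toFinset_card', Finset.card_eq_sum_ones, Set.toFinset_ofPred,
      Finset.sum_filter]
  rw [Finset.sum_congr rfl fun x _ => h1 x, Finset.sum_comm, ← Nat.card_coe_set_eq,
    Nat.card_eq_fintype_card, mul_comm, ← smul_eq_mul, ← Finset.card_univ, ← Finset.sum_const]
  refine Finset.sum_congr rfl fun e _ => ?_
  obtain ⟨u, v, he⟩ := G.exists_isLink_of_mem_edgeSet e.2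
  have hne : (⟨u, he.left_mem⟩ : V(G)) ≠ ⟨v, he.right_mem⟩ := fun h =>
    he.adj.ne (congrArg Subtype.val h)
  rw [Finset.sum_boole, Nat.cast_id, ← Finset.card_pair hne]
  congr 1
  ext x
  simp only [Finset.mem_filter, Finset.mem_univ, true_and, Finset.mem_insert,
    Finset.mem_singleton, Subtype.ext_iff]
  constructor
  · exact fun h => h.eq_or_eq_of_isLink he
  · rintro (h | h) <;> rw [h]
    exacts [he.inc_left, he.inc_right]

theorem two_mul_genus [Fintype V(G)] [Finite E(G)] [G.Loopless] :
    2 * G.genus = ∑ x, ((deg G.mult x : ℤ) - 2) + 2 := by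
  rw [Finset.sum_sub_distrib, ← Nat.cast_sum, sum_deg, genus, ← Nat.card_coe_set_eq V(G),
    Nat.card_eq_fintype_card]
  simp
  ring

/-- The edge `e` joins a vertex of `S` to a vertex outside `S`. -/
def Crosses (G : Graph α β) (S : Set V(G)) (e : β) : Prop :=
  ∃ x ∈ S, ∃ y ∉ S, G.IsLink e x y

/-- A graph is `2`-edge-connected if and only if each of its cuts contains two different edges. -/
theorem isEdgeConnected_two_iff [Finite E(G)] : G.IsEdgeConnected 2 ↔ Nonempty V(G) ∧
    ∀ S : Set V(G), S.Nonempty → Sᶜ.Nonempty → ∃ e e', e ≠ e' ∧ G.Crosses S e ∧ G.Crosses S e' := by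
  constructor
  · intro h
    refine ⟨?_, ?_⟩
    · obtain ⟨x⟩ := (h ∅ (by simp) (by simp) (by simp)).nonempty
      exact ⟨⟨x.1, by simpa using x.2⟩⟩
    · rintro S ⟨x, hx⟩ ⟨y, hy⟩
      by_contra hcon
      have hsub : {e | G.Crosses S e}.Subsingleton := fun e he e' he' => by
        by_contra hne
        exact hcon ⟨e, e', hne, he, he'⟩
      have hconn := h {e | G.Crosses S e} (fun e ⟨_, _, _, _, h⟩ => h.edge_mem) hsub.finite
        (by
          have := hsub.finite.to_subtype
          have := Set.ncard_le_one_iff_subsingleton.2 hsub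
          omega)
      have hx' : x.1 ∈ V(G.deleteEdges {e | G.Crosses S e}) := by simp
      have hy' : y.1 ∈ V(G.deleteEdges {e | G.Crosses S e}) := by simp
      obtain ⟨p⟩ := hconn.preconnected ⟨x, hx'⟩ ⟨y, hy'⟩
      obtain ⟨d, -, hd1, hd2⟩ := p.exists_boundary_dart
        {z | ∃ hz : z.1 ∈ V(G), (⟨z.1, hz⟩ : V(G)) ∈ S} ⟨x.2, hx⟩ (fun ⟨_, h⟩ => hy h)
      obtain ⟨hz, hzS⟩ := hd1
      obtain ⟨-, e, he⟩ := d.adj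
      rw [deleteEdges_isLink] at he
      exact he.2 ⟨_, hzS, ⟨_, he.1.right_mem⟩, fun h => hd2 ⟨_, h⟩, he.1⟩
  · rintro ⟨⟨x₀⟩, h⟩ W hW hfin hcard
    have hW1 : W.Subsingleton := by
      have := hfin.to_subtype
      exact Set.ncard_le_one_iff_subsingleton.1 (by omega)
    have : Nonempty V(G.deleteEdges W) := ⟨⟨x₀.1, by simp⟩⟩
    refine ⟨fun x y => ?_⟩
    by_contra hcon
    obtain ⟨e, e', hne, he, he'⟩ := h
      {z | (G.deleteEdges W).toSimpleGraph.Reachable x ⟨z.1, by simp⟩}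
      ⟨⟨x.1, by simpa using x.2⟩, SimpleGraph.Reachable.refl _⟩ ⟨⟨y.1, by simpa using y.2⟩, hcon⟩
    have key : ∀ e, G.Crosses
        {z | (G.deleteEdges W).toSimpleGraph.Reachable x ⟨z.1, by simp⟩} e → e ∈ W := by
      rintro e ⟨u, hu, v, hv, he⟩
      by_contra heW
      refine hv (SimpleGraph.Reachable.trans hu (SimpleGraph.Adj.reachable ⟨?_, e, ?_⟩))
      · intro huv
        have : u = v := Subtype.ext (congrArg Subtype.val huv)
        exact hv (this ▸ hu)
      · rw [deleteEdges_isLink]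
        exact ⟨he, heW⟩
    exact hne (hW1 (key e he) (key e' he'))

theorem IsEdgeConnected.isTwoEdgeConnected [Fintype V(G)] [DecidableEq V(G)] [Finite E(G)]
    [G.Loopless] (h : G.IsEdgeConnected 2) : IsTwoEdgeConnected G.mult := by
  classical
  refine ⟨mult_comm, mult_self, fun S ⟨x, hx⟩ ⟨y, hy⟩ => ?_⟩
  obtain ⟨e, e', hne, he, he'⟩ := (isEdgeConnected_two_iff.1 h).2 S ⟨x, hx⟩
    ⟨y, by simpa using hy⟩
  let t : V(G) × V(G) → Finset β := fun p => (finite_setOf_isLink (G := G) p.1 p.2).toFinset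
  have hsum : ∑ x ∈ S, outdeg G.mult S x = ∑ p ∈ S ×ˢ Sᶜ, (t p).card := by
    rw [Finset.sum_product]
    refine Finset.sum_congr rfl fun x _ => Finset.sum_congr rfl fun y _ => ?_
    rw [mult, Set.ncard_eq_toFinset_card _ (finite_setOf_isLink _ _)]
  rw [hsum, ← Finset.card_pair hne]
  refine le_trans (Finset.card_le_card ?_) Finset.card_biUnion_le
  have key : ∀ e, G.Crosses S e → e ∈ (S ×ˢ Sᶜ).biUnion t := by
    rintro e ⟨u, hu, v, hv, h⟩
    refine Finset.mem_biUnion.2 ⟨(u, v), ?_, by simpa [t] using h⟩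
    simpa using ⟨hu, hv⟩
  intro f hf
  rcases Finset.mem_insert.1 hf with rfl | hf
  · exact key _ he
  · rw [Finset.mem_singleton.1 hf]; exact key _ he'

/-! ### Isomorphisms with graphs given by their ends -/

theorem ofEnds_isLink {V E : Type*} {ends : E → V × V} {e : E} {x y : V} :
    (ofEnds ends).IsLink e x y ↔ s(x, y) = s((ends e).1, (ends e).2) := Iff.rfl

theorem bananaGraph_eq_ofEnds (n : ℕ) : bananaGraph n = ofEnds fun _ => (false, true) := by
  refine Graph.ext ?_ fun e x y => ?_
  · ext b; cases b <;> simp [bananaGraph, ofEnds]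
  · rw [ofEnds_isLink, bananaGraph, banana_isLink]
    simp

/-- The vertices of `ofEnds ends`. -/
def ofEndsVertex {V E : Type*} (ends : E → V × V) : V ≃ V(ofEnds ends) where
  toFun v := ⟨v, Set.mem_univ v⟩
  invFun := Subtype.val
  left_inv _ := rfl
  right_inv _ := rfl

/-- The edges of `ofEnds ends`. -/
def ofEndsEdge {V E : Type*} (ends : E → V × V) : E ≃ E(ofEnds ends) where
  toFun e := ⟨e, Set.mem_univ e⟩
  invFun := Subtype.val
  left_inv _ := rfl
  right_inv _ := rfl

theorem IsIsomorphic.exists_equiv {V E : Type*} {ends : E → V × V}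
    (h : G.IsIsomorphic (ofEnds ends)) :
    ∃ (φ : V ≃ V(G)) (ψ : E ≃ E(G)), ∀ e, G.IsLink (ψ e) (φ (ends e).1) (φ (ends e).2) := by
  obtain ⟨φ, ψ, hφ⟩ := h
  refine ⟨(ofEndsVertex ends).trans φ.symm, (ofEndsEdge ends).trans ψ.symm, fun e => ?_⟩
  refine (hφ _ _ _).2 ?_
  simp only [Equiv.trans_apply, Equiv.apply_symm_apply]
  exact ofEnds_isLink.2 rfl

/-- An injective morphism into a connected multigraph whose image contains all edges at all its
vertices is an isomorphism. -/
theorem isIsomorphic_ofEnds_of_injective [Fintype V(G)] [Finite E(G)] {V E : Type*}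
    {ends : E → V × V} {φ : V → V(G)} {ψ : E → E(G)}
    (hφ : φ.Injective) (hψ : ψ.Injective)
    (hlink : ∀ e, G.IsLink (ψ e) (φ (ends e).1) (φ (ends e).2)) (v₀ : V)
    (hconn : ∀ {p : V(G) → Prop} {a : V(G)}, p a → (∀ x y, p x → 0 < G.mult x y → p y) → ∀ x, p x)
    (hdeg : ∀ v, ∃ F : Finset E, (∀ e ∈ F, (ends e).1 = v ∨ (ends e).2 = v) ∧
      deg G.mult (φ v) ≤ F.card) :
    G.IsIsomorphic (ofEnds ends) := by
  classical
  have hinc : ∀ v (e : E(G)), G.Inc e (φ v) → ∃ e', ψ e' = e := by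
    intro v e he
    obtain ⟨F, hF, hcard⟩ := hdeg v
    rw [deg_eq_ncard] at hcard
    have hsub : ψ '' F ⊆ {e : E(G) | G.Inc e (φ v)} := by
      rintro _ ⟨e', he', rfl⟩
      rcases hF e' he' with h | h
      · rw [← h]; exact (hlink e').inc_left
      · rw [← h]; exact (hlink e').inc_right
    have heq := Set.eq_of_subset_of_ncard_le hsub (by
      rwa [Set.ncard_image_of_injective _ hψ, Set.ncard_coe_finset])
    have he2 : e ∈ ψ '' F := by rw [heq]; exact he
    obtain ⟨e', -, h⟩ := he2
    exact ⟨e', h⟩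
  have hsurj : φ.Surjective := by
    refine hconn (p := fun x => ∃ v, φ v = x) (a := φ v₀) ⟨v₀, rfl⟩ ?_
    rintro _ y ⟨v, rfl⟩ hpos
    obtain ⟨e, he⟩ := mult_pos_iff.1 hpos
    obtain ⟨e', he'⟩ := hinc v ⟨e, he.edge_mem⟩ he.inc_left
    have h1 := hlink e'
    rw [he'] at h1
    rcases he.right_eq_or_eq h1 with h2 | h2
    · exact ⟨_, (Subtype.ext h2).symm⟩
    · exact ⟨_, (Subtype.ext h2).symm⟩
  have hψsurj : ψ.Surjective := by
    intro e
    obtain ⟨x, y, hxy⟩ := G.exists_isLink_of_mem_edgeSet e.2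
    obtain ⟨v, hv⟩ := hsurj ⟨x, hxy.left_mem⟩
    refine hinc v e ?_
    rw [hv]
    exact hxy.inc_left
  let Φ := (Equiv.ofBijective φ ⟨hφ, hsurj⟩).symm.trans (ofEndsVertex ends)
  let Ψ := (Equiv.ofBijective ψ ⟨hψ, hψsurj⟩).symm.trans (ofEndsEdge ends)
  refine ⟨Φ, Ψ, ?_⟩
  intro e x y
  obtain ⟨e, rfl⟩ := Ψ.symm.surjective e
  obtain ⟨x, rfl⟩ := Φ.symm.surjective x
  obtain ⟨y, rfl⟩ := Φ.symm.surjective y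
  simp only [Equiv.apply_symm_apply]
  have h1 := hlink e.1
  rw [ofEnds_isLink]
  have h2 : Ψ.symm e = ψ e.1 := rfl
  have h3 : ∀ x, Φ.symm x = φ x.1 := fun _ => rfl
  rw [h2, h3, h3, h1.isLink_iff, Sym2.eq_iff]
  simp only [← Subtype.ext_iff, hφ.eq_iff]
  constructor
  · rintro (⟨h, h'⟩ | ⟨h, h'⟩) <;> tauto
  · rintro (⟨h, h'⟩ | ⟨h, h'⟩) <;> tauto

/-! ### Divisors and ranks -/

namespace Divisor

variable [Fintype V(G)] [DecidableEq V(G)]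

theorem point_eq_pt (x : V(G)) : (point x : Divisor G) = pt x := by
  ext y
  rw [pt_apply, point]
  congr

theorem principal_eq_lap (f : V(G) → ℤ) : (principal f : Divisor G) = lap G.mult f := rfl

theorem linearEquivalent_iff {D D' : Divisor G} :
    LinearEquivalent D D' ↔ D - D' ∈ Multiplicity.principal G.mult :=
  ⟨fun ⟨f, hf⟩ => ⟨f, hf.symm⟩, fun ⟨f, hf⟩ => ⟨f, hf.symm⟩⟩

theorem mem_rankSet_of_le [Nonempty V(G)] {D : Divisor G} {k m : ℤ} (hm : m ∈ rankSet D)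
    (hkm : k ≤ m) : k ∈ rankSet D := by
  intro E hE hdeg
  obtain ⟨v⟩ := ‹Nonempty V(G)›
  have hnn : 0 ≤ (m - k) • pt v := smul_nonneg (by omega) (pt_nonneg v)
  obtain ⟨F, hF, hFE⟩ := hm (E + (m - k) • pt v) (add_nonneg hE hnn) (by
    rw [degree] at hdeg ⊢
    simp only [Pi.add_apply, Pi.smul_apply, Finset.sum_add_distrib, hdeg, ← Finset.smul_sum, sum_pt]
    simp)
  refine ⟨F + (m - k) • pt v, add_nonneg hF hnn, ?_⟩
  rw [linearEquivalent_iff] at hFE ⊢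
  convert hFE using 1
  abel

theorem one_le_rank_iff [Nonempty V(G)] {D : Divisor G} :
    1 ≤ rank D ↔ ∀ v, ∃ E : V(G) → ℤ, 0 ≤ E ∧ E - (D - pt v) ∈ Multiplicity.principal G.mult := by
  constructor
  · intro h v
    have hne : (linearSystem D).Nonempty := by
      by_contra hne
      rw [rank, if_neg hne] at h
      omega
    obtain ⟨E, hE, hED⟩ := mem_rankSet_of_le (isGreatest_rank D hne).1 h (pt v) (pt_nonneg v)
      (by rw [degree, sum_pt, if_pos (Finset.mem_univ _)])
    exact ⟨E, hE, linearEquivalent_iff.1 hED⟩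
  · intro h
    have hne : (linearSystem D).Nonempty := by
      obtain ⟨v⟩ := ‹Nonempty V(G)›
      obtain ⟨E, hE, hED⟩ := h v
      refine ⟨E + pt v, add_nonneg hE (pt_nonneg v), linearEquivalent_iff.2 ?_⟩
      convert hED using 1
      abel
    refine (isGreatest_rank D hne).2 fun F hF hdeg => ?_
    obtain ⟨v, rfl⟩ := exists_eq_pt hF hdeg
    obtain ⟨E, hE, hED⟩ := h v
    exact ⟨E, hE, linearEquivalent_iff.2 hED⟩

/-- On a `2`-edge-connected graph with more than one vertex, the rank of a divisor of degree two is
at most one. -/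
theorem rank_le_one (hG : IsTwoEdgeConnected G.mult) {x y : V(G)} (hxy : x ≠ y) {D : Divisor G}
    (hD : degree D = 2) : rank D ≤ 1 := by
  by_contra! h
  have : Nonempty V(G) := ⟨x⟩
  have hne : (linearSystem D).Nonempty := by
    by_contra hne
    rw [rank, if_neg hne] at h
    omega
  have h2 : 2 ∈ rankSet D := mem_rankSet_of_le (isGreatest_rank D hne).1 (by omega)
  have key : ∀ z w, D - (pt z + pt w) ∈ Multiplicity.principal G.mult := by
    intro z w
    obtain ⟨E, hE, hED⟩ := h2 (pt z + pt w) (add_nonneg (pt_nonneg z) (pt_nonneg w)) (by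
      simp [degree, Finset.sum_add_distrib, sum_pt])
    rw [linearEquivalent_iff] at hED
    obtain ⟨f, hf⟩ := hED
    have h0 : ∑ v, E v = 0 := by
      have h1 := degree_principal f
      rw [principal_eq_lap, hf] at h1
      simp only [degree, Pi.sub_apply, Pi.add_apply, Finset.sum_sub_distrib,
        Finset.sum_add_distrib, sum_pt, Finset.mem_univ, if_true] at h1 hD
      omega
    have hE0 : E = 0 := by
      ext v
      exact (Finset.sum_eq_zero_iff_of_nonneg fun i _ => hE i).1 h0 v (Finset.mem_univ v)
    rw [hE0] at hf
    refine (neg_mem_iff).1 ⟨f, ?_⟩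
    rw [hf]
    abel
  refine hxy (hG.eq_of_pt_sub_pt_mem ?_)
  convert (Multiplicity.principal G.mult).sub_mem (key y y) (key x y) using 1
  abel

end Divisor

/-! ### The involution of a hyperelliptic graph without Weierstrass points -/

section Involution

variable [Fintype V(G)] [DecidableEq V(G)] [Finite E(G)] [G.Loopless]

/-- On a hyperelliptic graph without Weierstrass points, the divisors of degree two and rank one
define an involution without fixed points: a fixed vertex `x` would satisfy `r(2x) = 1`. Moreover,
a vertex `x` adjacent to `ι x` has degree at least `g`: otherwise firing `x` turns `g x` into an
effective divisor containing `x + ι x`. -/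
theorem exists_hyperellipticInvolution (hh : G.IsHyperelliptic)
    (hW : ∀ x : V(G), ¬ G.IsWeierstrassPoint x) :
    ∃ ι : V(G) → V(G), IsHyperellipticInvolution G.mult ι ∧
      ∀ x, 0 < G.mult x (ι x) → G.genus ≤ deg G.mult x := by
  obtain ⟨hg, D, hdeg, hrank⟩ := hh
  rcases isEmpty_or_nonempty V(G) with hemp | hne
  · exact ⟨id, ⟨isEmptyElim, isEmptyElim⟩, isEmptyElim⟩
  have hex : ∀ v, ∃ w, pt w - (D - pt v) ∈ Multiplicity.principal G.mult := by
    intro v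
    obtain ⟨E, hE, hED⟩ := Divisor.one_le_rank_iff.1 hrank.ge v
    have h1 : ∑ x, E x = 1 := by
      obtain ⟨f, hf⟩ := id hED
      have h2 := Divisor.degree_principal f
      rw [Divisor.principal_eq_lap, hf] at h2
      simp only [Divisor.degree, Pi.sub_apply, Finset.sum_sub_distrib, sum_pt, Finset.mem_univ,
        if_true] at h2 hdeg
      omega
    obtain ⟨w, rfl⟩ := exists_eq_pt hE h1
    exact ⟨w, hED⟩
  choose ι hι using hex
  have hmem : ∀ x y, pt x + pt (ι x) - pt y - pt (ι y) ∈ Multiplicity.principal G.mult := by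
    intro x y
    convert (Multiplicity.principal G.mult).sub_mem (hι x) (hι y) using 1
    abel
  have hW' : ∀ x, ¬ ∀ v, ∃ E : V(G) → ℤ, 0 ≤ E ∧
      E - (G.genus • pt x - pt v) ∈ Multiplicity.principal G.mult := by
    intro x
    have := hW x
    rwa [IsWeierstrassPoint, Divisor.one_le_rank_iff, Divisor.point_eq_pt] at this
  have hfix : ∀ x, ι x ≠ x := by
    intro x hx
    refine hW' x fun v => ⟨(G.genus - 2) • pt x + pt (ι v),
      add_nonneg (smul_nonneg (by omega) (pt_nonneg x)) (pt_nonneg _), ?_⟩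
    have h1 := hmem v x
    rw [hx] at h1
    convert h1 using 1
    rw [sub_smul, two_smul]
    abel
  refine ⟨ι, ⟨hfix, hmem⟩, fun x hx => ?_⟩
  by_contra! hlt
  refine hW' x fun v => ⟨((G.genus - deg G.mult x) • pt x + fun y => (G.mult x y : ℤ))
    - pt x - pt (ι x) + pt (ι v), ?_, ?_⟩
  · refine add_nonneg (fun y => ?_) (pt_nonneg _)
    have h1 := hfix x
    simp only [Pi.zero_apply, Pi.sub_apply, Pi.add_apply, Pi.smul_apply, smul_eq_mul, pt_apply]
    by_cases hy : y = x
    · subst hy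
      simp [h1.symm]
      omega
    · by_cases hy' : y = ι x
      · subst hy'
        simp [h1]
        omega
      · simp [hy, hy']
  · have h1 := (Multiplicity.principal G.mult).sub_mem (hmem v x)
      (deg_smul_pt_sub_mem (μ := G.mult) mult_self mult_comm x)
    convert h1 using 1
    rw [sub_smul]
    abel

end Involution

/-! ### Classification of the doubled trees without Weierstrass points -/

/-- Enough elements of a finite set can be indexed by a given finite type. -/
theorem exists_injective_of_le_ncard {γ δ : Type*} [Fintype δ] {s : Set γ} (hs : s.Finite)
    (h : Fintype.card δ ≤ s.ncard) : ∃ f : δ → γ, f.Injective ∧ ∀ d, f d ∈ s := by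
  have := hs.fintype
  rw [Set.ncard_eq_toFinset_card', Set.toFinset_card] at h
  obtain ⟨f⟩ := Function.Embedding.nonempty_of_card_le h
  exact ⟨fun d => f d, Subtype.val_injective.comp f.injective, fun d => (f d).2⟩

section Classification

variable [Fintype V(G)] [DecidableEq V(G)] [Finite E(G)] [G.Loopless] {ι : V(G) → V(G)}

theorem exists_isIsomorphic_bananaGraph (h : IsDoubleTree G.mult ι) (hg : 2 ≤ G.genus) {a : V(G)}
    (ha : ∀ x, x = a ∨ x = ι a) : ∃ n, 3 ≤ n ∧ G.IsIsomorphic (bananaGraph n) := by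
  have hne := h.ne a
  have huniv : (Finset.univ : Finset V(G)) = {a, ι a} := by
    ext x; simpa using ha x
  have hdeg : deg G.mult a = G.mult a (ι a) := by
    rw [deg, huniv, Finset.sum_pair hne.symm, mult_self, zero_add]
  have hgen := two_mul_genus (G := G)
  rw [huniv, Finset.sum_pair hne.symm, h.deg_map, hdeg] at hgen
  refine ⟨G.mult a (ι a), by omega, ?_⟩
  obtain ⟨f, hf, hfl⟩ := exists_injective_of_le_ncard (δ := Fin (G.mult a (ι a)))
    (finite_setOf_isLink (G := G) a (ι a)) (by rw [Fintype.card_fin]; rfl)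
  rw [bananaGraph_eq_ofEnds]
  refine isIsomorphic_ofEnds_of_injective (φ := fun b => bif b then ι a else a)
    (ψ := fun i => ⟨f i, (hfl i).edge_mem⟩) ?_ ?_ hfl false h.induction ?_
  · rintro (_ | _) (_ | _) hb
    · rfl
    · exact absurd hb.symm hne
    · exact absurd hb hne
    · rfl
  · exact fun i j hij => hf (congrArg Subtype.val hij)
  · refine fun v => ⟨Finset.univ, fun e _ => by cases v <;> simp, ?_⟩
    rw [Finset.card_univ, Fintype.card_fin]
    cases v
    · exact hdeg.le
    · exact ((h.deg_map a).trans hdeg).le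

/-- Any set of vertices contributes at most `2 g - 2` to the sum of all `deg x - 2`. -/
theorem sum_deg_le (hdeg : ∀ x : V(G), 2 ≤ deg G.mult x) (S : Finset V(G)) :
    ∑ x ∈ S, ((deg G.mult x : ℤ) - 2) + 2 ≤ 2 * G.genus := by
  rw [two_mul_genus]
  have := Finset.sum_le_sum_of_subset_of_nonneg (f := fun x => (deg G.mult x : ℤ) - 2)
    (Finset.subset_univ S) (fun x _ _ => by have := hdeg x; omega)
  omega

/-- A doubled tree whose tree is a path, with two vertical edges at both ends. -/
theorem isIsomorphic_phiGraph (h : IsDoubleTree G.mult ι) {a b : V(G)}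
    (hb : b ≠ a) (hb' : b ≠ ι a) (ha2 : G.mult a (ι a) = 2) (hb2 : G.mult b (ι b) = 2)
    (hda : deg G.mult a = 3) (hdb : deg G.mult b = 3)
    (hd : ∀ x, x ≠ a → x ≠ ι a → x ≠ b → x ≠ ι b → deg G.mult x = 2) :
    ∃ l, 1 ≤ l ∧ G.IsIsomorphic (phiGraph l) := by
  set p := parent G.mult ι a with hp
  set d := depth G.mult ι a with hd_def
  -- replacing `b` by `ι b`, it lies in the same copy of the path as `a`
  wlog hba : p^[d b] b = a generalizing b
  · have h1 := (h.iterate_depth a b).resolve_left hba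
    refine this (b := ι b) ?_ ?_ ?_ ?_ ?_ ?_
    · intro h2; exact hb' (by rw [← h2, h.involutive])
    · intro h2; exact hb (by rw [← h.involutive b, h2, h.involutive])
    · rw [h.map, hb2]
    · rw [h.deg_map, hdb]
    · intro x h1 h2 h3 h4
      rw [h.involutive] at h4
      exact hd x h1 h2 h4 h3
    · rw [hd_def, h.depth_map, hp, h.iterate_map le_rfl, h1, h.involutive]
  have hl : d b ≠ 0 := fun h0 => by
    rcases h.depth_eq_zero.1 h0 with h1 | h1
    exacts [hb h1, hb' h1]
  generalize hlen : d b = l at *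
  have hdw : ∀ k ≤ l, d (p^[l - k] b) = k := fun k hk => by
    rw [hd_def, hp, h.depth_iterate (by rw [← hd_def, hlen]; omega), ← hd_def, hlen]
    omega
  have hinv : Function.Injective ι := fun x y hxy => by rw [← h.involutive x, hxy, h.involutive]
  let w : ℕ → V(G) := fun k => p^[l - k] b
  have hdw : ∀ k ≤ l, d (w k) = k := hdw
  have hw0 : w 0 = a := hba
  have hwl : w l = b := by simp [w]
  have hwp : ∀ k < l, w k = p (w (k + 1)) := fun k hk => by
    simp only [w]
    rw [← Function.iterate_succ_apply' p]
    congr 2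
    omega
  let φ : Bool × Fin (l + 1) → V(G) := fun v => bif v.1 then ι (w v.2) else w v.2
  have hdφ : ∀ v, d (φ v) = v.2 := by
    rintro ⟨_ | _, i⟩
    · exact hdw i (by omega)
    · exact (h.depth_map a _).trans (hdw i (by omega))
  have hφ : φ.Injective := by
    intro u v huv
    have h1 : (u.2 : ℕ) = v.2 := by rw [← hdφ, ← hdφ, huv]
    obtain ⟨b₁, i⟩ := u
    obtain ⟨b₂, j⟩ := v
    obtain rfl : i = j := Fin.ext h1
    rcases b₁ with _ | _ <;> rcases b₂ with _ | _
    · rfl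
    · exact absurd huv.symm (h.ne _)
    · exact absurd huv (h.ne _)
    · rfl
  have hedge : ∀ x y : V(G), 0 < G.mult x y → ∃ e : E(G), G.IsLink e x y := fun x y hxy => by
    obtain ⟨e, he⟩ := mult_pos_iff.1 hxy
    exact ⟨⟨e, he.edge_mem⟩, he⟩
  obtain ⟨f₀, hf₀, hfl₀⟩ := exists_injective_of_le_ncard (δ := Bool)
    (finite_setOf_isLink (G := G) a (ι a)) (by rw [Fintype.card_bool]; exact ha2.ge)
  obtain ⟨f₁, hf₁, hfl₁⟩ := exists_injective_of_le_ncard (δ := Bool)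
    (finite_setOf_isLink (G := G) b (ι b)) (by rw [Fintype.card_bool]; exact hb2.ge)
  have hpath : ∀ i : Fin l, ∃ e : E(G), G.IsLink e (w i) (w (i + 1)) := fun i => by
    refine hedge _ _ ?_
    rw [hwp i i.2]
    have hdi := hdw (i + 1) (by omega)
    exact (h.parent_spec (a := a) (x := w (i + 1)) (by rw [← hd_def]; omega)).1
  have hpath' : ∀ i : Fin l, ∃ e : E(G), G.IsLink e (ι (w i)) (ι (w (i + 1))) := fun i => by
    refine hedge _ _ ?_
    rw [h.map, hwp i i.2]
    have hdi := hdw (i + 1) (by omega)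
    exact (h.parent_spec (a := a) (x := w (i + 1)) (by rw [← hd_def]; omega)).1
  choose q hq using hpath
  choose q' hq' using hpath'
  let ψ : (Bool × Fin l) ⊕ (Bool × Bool) → E(G)
    | Sum.inl (false, i) => q i
    | Sum.inl (true, i) => q' i
    | Sum.inr (false, c) => ⟨f₀ c, (hfl₀ c).edge_mem⟩
    | Sum.inr (true, c) => ⟨f₁ c, (hfl₁ c).edge_mem⟩
  let ends : (Bool × Fin l) ⊕ (Bool × Bool) → (Bool × Fin (l + 1)) × (Bool × Fin (l + 1)) := fun
    | Sum.inl (b, i) => ((b, i.castSucc), (b, i.succ))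
    | Sum.inr (false, _) => ((false, 0), (true, 0))
    | Sum.inr (true, _) => ((false, Fin.last l), (true, Fin.last l))
  have hends : phiGraph l = ofEnds ends := by
    unfold phiGraph
    congr 1
  have hlink : ∀ e, G.IsLink (ψ e) (φ (ends e).1) (φ (ends e).2) := by
    rintro (⟨_ | _, i⟩ | ⟨_ | _, c⟩)
    · exact hq i
    · exact hq' i
    · have := hfl₀ c
      rw [← hw0] at this
      exact this
    · have := hfl₁ c
      rw [← hwl] at this
      exact this
  have hψ : ψ.Injective := by
    intro e e' hee
    have h1 := hlink e
    rw [hee] at h1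
    have h2 := h1.eq_and_eq_or_eq_and_eq (hlink e')
    simp only [← Subtype.ext_iff, hφ.eq_iff] at h2
    rcases e with ⟨b₁, i⟩ | ⟨b₁, c⟩ <;> rcases e' with ⟨b₂, j⟩ | ⟨b₂, c'⟩
    · simp only [ends, Prod.mk.injEq, Fin.ext_iff, Fin.val_castSucc, Fin.val_succ] at h2
      have hij : b₁ = b₂ ∧ i = j := by
        rcases h2 with h2 | h2
        · exact ⟨h2.1.1, Fin.ext h2.1.2⟩
        · omega
      rw [hij.1, hij.2]
    · exfalso
      cases b₂ <;> simp only [ends, Prod.mk.injEq, Fin.ext_iff, Fin.val_castSucc, Fin.val_succ] at h2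
        <;> omega
    · exfalso
      cases b₁ <;> simp only [ends, Prod.mk.injEq, Fin.ext_iff, Fin.val_castSucc, Fin.val_succ] at h2
        <;> omega
    · rcases b₁ with _ | _ <;> rcases b₂ with _ | _ <;>
        simp only [ends, Prod.mk.injEq, Fin.ext_iff, Fin.val_zero, Fin.val_last] at h2
      · rw [hf₀ (congrArg Subtype.val hee)]
      · omega
      · omega
      · rw [hf₁ (congrArg Subtype.val hee)]
  refine ⟨l, by omega, ?_⟩
  rw [hends]
  refine isIsomorphic_ofEnds_of_injective hφ hψ hlink (false, 0) h.induction ?_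
  have hdegφ : ∀ c i, deg G.mult (φ (c, i)) = deg G.mult (w i) := by
    rintro (_ | _) i
    · rfl
    · exact h.deg_map _
  rintro ⟨c, i⟩
  rw [hdegφ]
  by_cases hi0 : (i : ℕ) = 0
  · refine ⟨{Sum.inl (c, ⟨0, by omega⟩), Sum.inr (false, false), Sum.inr (false, true)}, ?_, ?_⟩
    · have : i = 0 := Fin.ext hi0
      subst this
      intro e he
      simp only [Finset.mem_insert, Finset.mem_singleton] at he
      rcases he with rfl | rfl | rfl
      · left; rfl
      · cases c <;> simp [ends]
      · cases c <;> simp [ends]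
    · rw [hi0, hw0, hda]; simp
  by_cases hil : (i : ℕ) = l
  · refine ⟨{Sum.inl (c, ⟨l - 1, by omega⟩), Sum.inr (true, false), Sum.inr (true, true)}, ?_, ?_⟩
    · have : i = Fin.last l := Fin.ext hil
      subst this
      intro e he
      simp only [Finset.mem_insert, Finset.mem_singleton] at he
      rcases he with rfl | rfl | rfl
      · right
        simp only [ends, Prod.mk.injEq, Fin.ext_iff, true_and, Fin.val_succ, Fin.val_last]
        omega
      · cases c <;> simp [ends]
      · cases c <;> simp [ends]
    · rw [hil, hwl, hdb]; simp
  · have hil' : (i : ℕ) < l := by omega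
    refine ⟨{Sum.inl (c, ⟨i - 1, by omega⟩), Sum.inl (c, ⟨i, hil'⟩)}, ?_, ?_⟩
    · intro e he
      simp only [Finset.mem_insert, Finset.mem_singleton] at he
      rcases he with rfl | rfl
      · right
        simp only [ends, Prod.mk.injEq, Fin.ext_iff, true_and, Fin.val_succ]
        omega
      · left; rfl
    · have hdi := hdw i hil'.le
      have hne : ∀ y, d y = 0 ∨ d y = l → w i ≠ y := by
        rintro _ hy rfl
        omega
      rw [hd (w i) (hne _ (Or.inl h.depth_self)) (hne _ (Or.inl (by
        rw [hd_def, h.depth_map, h.depth_self]))) (hne _ (Or.inr hlen))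
        (hne _ (Or.inr (by rw [hd_def, h.depth_map]; exact hlen))), Finset.card_pair]
      simp only [ne_eq, Sum.inl.injEq, Prod.mk.injEq, Fin.mk.injEq, true_and]
      omega

/-- In genus at least three, two pairs of leaves of degree at least `g` exhaust the sum `2 g - 2` of
all `deg x - 2`, so that `g = 3` and there is no further branching. -/
theorem exists_isIsomorphic_phiGraph (h : IsDoubleTree G.mult ι)
    (hdeg : ∀ x : V(G), 2 ≤ deg G.mult x)
    (hW : ∀ x, 0 < G.mult x (ι x) → G.genus ≤ deg G.mult x) (hg : 3 ≤ G.genus)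
    (hV : ∀ a : V(G), ∃ x, x ≠ a ∧ x ≠ ι a) (a : V(G)) :
    ∃ l, 1 ≤ l ∧ G.IsIsomorphic (phiGraph l) := by
  -- the vertices farthest from any root are leaves
  have hleaf : ∀ a : V(G), ∃ x, x ≠ a ∧ x ≠ ι a ∧ G.genus ≤ deg G.mult x ∧
      deg G.mult x = G.mult x (ι x) + 1 := by
    intro a
    obtain ⟨x, hk, hmax⟩ := h.exists_kids_eq_zero a
    obtain ⟨y, hy, hy'⟩ := hV a
    have hy0 : depth G.mult ι a y ≠ 0 := fun h0 => by
      rcases h.depth_eq_zero.1 h0 with h1 | h1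
      exacts [hy h1, hy' h1]
    have hx0 : depth G.mult ι a x ≠ 0 := by have := hmax y; omega
    have h1 := h.deg_eq a x
    rw [if_neg hx0, hk] at h1
    refine ⟨x, ?_, ?_, hW x (by have := hdeg x; omega), h1⟩
    · rintro rfl; exact hx0 h.depth_self
    · rintro rfl; exact hx0 (by rw [h.depth_map, h.depth_self])
  obtain ⟨b, -, -, hb1, hb2⟩ := hleaf a
  obtain ⟨c, hcb, hcb', hc1, hc2⟩ := hleaf b
  have hbb := h.ne b
  have hcc := h.ne c
  have h1 : ι c ≠ b := by rintro rfl; exact hcb' (h.involutive c).symm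
  have h2 : ι c ≠ ι b := fun h2 => hcb (by rw [← h.involutive c, h2, h.involutive])
  have hsum := sum_deg_le hdeg {b, ι b, c, ι c}
  rw [Finset.sum_insert (by simp [hbb.symm, hcb.symm, h1.symm]),
    Finset.sum_insert (by simp [hcb'.symm, h2.symm]), Finset.sum_pair hcc.symm, h.deg_map,
    h.deg_map] at hsum
  refine isIsomorphic_phiGraph h (a := b) (b := c) hcb hcb' (by omega) (by omega) (by omega)
    (by omega) fun x hx1 hx2 hx3 hx4 => ?_
  have hsum2 := sum_deg_le hdeg {x, b, ι b, c, ι c}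
  rw [Finset.sum_insert (by simp [hx1, hx2, hx3, hx4]),
    Finset.sum_insert (by simp [hbb.symm, hcb.symm, h1.symm]),
    Finset.sum_insert (by simp [hcb'.symm, h2.symm]), Finset.sum_pair hcc.symm, h.deg_map,
    h.deg_map] at hsum2
  have := hdeg x
  omega

end Classification

/-! ### Genus two: doubled trees with three legs -/

section GenusTwo

variable [Fintype V(G)] [DecidableEq V(G)] [Finite E(G)] [G.Loopless] {ι : V(G) → V(G)}

/-- A doubled tree has `g + 1` edges that join a vertex to its image: the other edges are determined
by the vertex farther from the root. -/
theorem genus_lt_ncard_vertical (h : IsDoubleTree G.mult ι) (a : V(G)) :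
    G.genus + 1 ≤ ({e | ∃ x : V(G), G.IsLink e x (ι x)}.ncard : ℤ) := by
  classical
  have hex : ∀ x : {x : V(G) // depth G.mult ι a x ≠ 0}, ∃ e,
      G.IsLink e x.1 (parent G.mult ι a x.1 : V(G)) := fun x => by
    refine mult_pos_iff.1 ?_
    rw [h.mult_parent x.2]
    exact one_pos
  choose q hq using hex
  have hsub : E(G) ⊆ {e | ∃ x : V(G), G.IsLink e x (ι x)} ∪ Set.range q := by
    intro e he
    obtain ⟨x, y, hxy⟩ := G.exists_isLink_of_mem_edgeSet he
    have key : ∀ x y : V(G), G.IsLink e x y → depth G.mult ι a x ≠ 0 →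
        y = parent G.mult ι a x → e ∈ Set.range q := by
      rintro x y hxy hx rfl
      refine ⟨⟨x, hx⟩, ?_⟩
      have h1 := h.mult_parent hx
      rw [mult] at h1
      obtain ⟨e', he'⟩ := Set.ncard_eq_one.1 h1
      have h2 : e ∈ {e | G.IsLink e x (parent G.mult ι a x : V(G))} := hxy
      have h3 : q ⟨x, hx⟩ ∈ {e | G.IsLink e x (parent G.mult ι a x : V(G))} := hq ⟨x, hx⟩
      rw [he', Set.mem_singleton_iff] at h2 h3
      rw [h2, h3]
    by_cases hy : (⟨y, hxy.right_mem⟩ : V(G)) = ι ⟨x, hxy.left_mem⟩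
    · refine Or.inl ⟨⟨x, hxy.left_mem⟩, ?_⟩
      rw [← hy]
      exact hxy
    · right
      rcases h.parent_or_parent a (mult_pos_iff.2 ⟨e, hxy⟩) hy with h1 | h1
      · exact key _ _ hxy h1.1 h1.2
      · exact key _ _ hxy.symm h1.1 h1.2
  have hfin : ({e | ∃ x : V(G), G.IsLink e x (ι x)} ∪ Set.range q).Finite :=
    ((Set.toFinite E(G)).subset (by rintro e ⟨x, hx⟩; exact hx.edge_mem)).union (Set.finite_range q)
  have h1 := (Set.ncard_le_ncard hsub hfin).trans (Set.ncard_union_le _ _)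
  have h2 : (Set.range q).ncard + 2 ≤ V(G).ncard := by
    have h3 : (Set.range q).ncard ≤ (Finset.univ \ {a, ι a} : Finset V(G)).card := by
      rw [← Set.image_univ]
      refine (Set.ncard_image_le Set.finite_univ).trans ?_
      rw [Set.ncard_univ, Nat.card_eq_fintype_card, Fintype.card_subtype]
      refine Finset.card_le_card fun x hx => ?_
      simp only [Finset.mem_filter, Finset.mem_univ, true_and, Finset.mem_sdiff,
        Finset.mem_insert, Finset.mem_singleton] at hx ⊢
      exact fun h4 => hx (h.depth_eq_zero.2 h4)
    have h4 := Finset.card_sdiff_add_card_eq_card (Finset.subset_univ ({a, ι a} : Finset V(G)))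
    rw [Finset.card_pair (h.ne a).symm, Finset.card_univ, ← Nat.card_eq_fintype_card,
      Nat.card_coe_set_eq] at h4
    omega
  rw [genus]
  omega

/-- A doubled tree in which only the root branches, with three vertical edges: the edge `f j`
sits at the end of the leg that joins the leaf `x j` to the root. -/
theorem exists_isIsomorphic_pathsGraph (h : IsDoubleTree G.mult ι) (hg : 2 ≤ G.genus) {a : V(G)}
    (ha : deg G.mult a = 3) (hd : ∀ x, x ≠ a → x ≠ ι a → deg G.mult x = 2) :
    ∃ l : Fin 3 → ℕ, (∀ j, Odd (l j)) ∧ G.IsIsomorphic (pathsGraph l) := by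
  set p := parent G.mult ι a with hp
  set d := depth G.mult ι a with hd_def
  have hinv : Function.Injective ι := fun x y hxy => by rw [← h.involutive x, hxy, h.involutive]
  have hd2 : ∀ x, d x ≠ 0 → deg G.mult x = 2 := fun x hx =>
    hd x (by rintro rfl; exact hx h.depth_self)
      (by rintro rfl; exact hx (by rw [hd_def, h.depth_map, h.depth_self]))
  have hdeg : ∀ x, d x ≠ 0 → G.mult x (ι x) + kids G.mult ι a x = 1 := fun x hx => by
    have h1 := h.deg_eq a x
    rw [hd2 x hx, if_neg hx] at h1
    omega
  obtain ⟨f, hf, hfl⟩ := exists_injective_of_le_ncard (δ := Fin 3)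
    (s := {e | ∃ x : V(G), G.IsLink e x (ι x)})
    ((Set.toFinite E(G)).subset (by rintro e ⟨x, hx⟩; exact hx.edge_mem)) (by
      have := genus_lt_ncard_vertical h a
      rw [Fintype.card_fin]
      omega)
  have hfl' : ∀ j, ∃ x : V(G), G.IsLink (f j) x (ι x) ∧ p^[d x] x = a := by
    intro j
    obtain ⟨x, hx⟩ := hfl j
    rcases h.iterate_depth a x with h1 | h1
    · exact ⟨x, hx, h1⟩
    · refine ⟨ι x, by rw [h.involutive]; exact hx.symm, ?_⟩
      rw [hd_def, h.depth_map, hp, h.iterate_map le_rfl, h1, h.involutive]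
  choose x hx hxa using hfl'
  have hmx : ∀ j, 0 < G.mult (x j) (ι (x j)) := fun j => mult_pos_iff.2 ⟨f j, hx j⟩
  -- the vertex number `k` of the path with index `j`
  let w : Fin 3 → ℕ → V(G) := fun j k =>
    if k ≤ d (x j) then p^[d (x j) - k] (x j) else ι (p^[k - d (x j) - 1] (x j))
  have hwlow : ∀ {j k}, k ≤ d (x j) → w j k = p^[d (x j) - k] (x j) := fun hk => if_pos hk
  have hwhigh : ∀ {j k}, ¬ k ≤ d (x j) → w j k = ι (p^[k - d (x j) - 1] (x j)) :=
    fun hk => if_neg hk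
  have hdlow : ∀ {j k}, k ≤ d (x j) → d (w j k) = k := fun {j k} hk => by
    rw [hwlow hk, hd_def, hp, h.depth_iterate (by rw [← hd_def]; omega), ← hd_def]
    omega
  have hdhigh : ∀ {j k}, ¬ k ≤ d (x j) → k ≤ 2 * d (x j) + 1 →
      d (w j k) = 2 * d (x j) + 1 - k := fun {j k} hk hk' => by
    rw [hwhigh hk, hd_def, h.depth_map, hp, h.depth_iterate (by rw [← hd_def]; omega), ← hd_def]
    omega
  have hw0 : ∀ j, w j 0 = a := fun j => by rw [hwlow (Nat.zero_le _)]; exact hxa j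
  have hwl : ∀ j, w j (2 * d (x j) + 1) = ι a := fun j => by
    rw [hwhigh (by omega), ← hxa j]
    congr 3
    omega
  have hslow : ∀ {j k}, k ≤ d (x j) → p^[k] (w j k) = a := fun {j k} hk => by
    rw [hwlow hk, ← Function.iterate_add_apply, Nat.add_sub_cancel' hk, hxa]
  have hshigh : ∀ {j k}, ¬ k ≤ d (x j) → k ≤ 2 * d (x j) + 1 →
      p^[2 * d (x j) + 1 - k] (w j k) = ι a := fun {j k} hk hk' => by
    rw [hwhigh hk, hp, h.iterate_map, ← hp, ← Function.iterate_add_apply,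
      show 2 * d (x j) + 1 - k + (k - d (x j) - 1) = d (x j) by omega, hxa]
    rw [h.depth_iterate (by rw [← hd_def]; omega), ← hd_def]
    omega
  have hkids : ∀ j, d (x j) ≠ 0 → kids G.mult ι a (x j) = 0 ∧ G.mult (x j) (ι (x j)) = 1 :=
    fun j hj => by
      have := hdeg _ hj
      have := hmx j
      omega
  -- the three paths are internally disjoint
  have hlowinj : ∀ {j k j' k'}, k ≠ 0 → k ≤ d (x j) → k' ≠ 0 → k' ≤ d (x j') →
      w j k = w j' k' → j = j' ∧ k = k' := by
    intro j k j' k' hk0 hk hk0' hk' hww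
    rw [hwlow hk, hwlow hk'] at hww
    have h1 := h.eq_of_iterate_eq (a := a) (fun z hz => by have := hdeg z hz; omega)
      (hkids j (by omega)).1 (hkids j' (by omega)).1 (by rw [← hd_def]; omega)
      (by rw [← hd_def]; omega) hww
    have h2 : j = j' := by
      have h3 := (hkids j (by omega)).2
      rw [mult] at h3
      obtain ⟨e, he⟩ := Set.ncard_eq_one.1 h3
      have h4 : f j ∈ {e | G.IsLink e (x j) (ι (x j))} := hx j
      have h5 : f j' ∈ {e | G.IsLink e (x j) (ι (x j))} := by rw [h1.1]; exact hx j'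
      rw [he, Set.mem_singleton_iff] at h4 h5
      exact hf (h4.trans h5.symm)
    subst h2
    exact ⟨rfl, by omega⟩
  have hwinj : ∀ {j k j' k'}, k ≠ 0 → k ≤ 2 * d (x j) → k' ≠ 0 → k' ≤ 2 * d (x j') →
      w j k = w j' k' → j = j' ∧ k = k' := by
    intro j k j' k' hk0 hk hk0' hk' hww
    by_cases h1 : k ≤ d (x j) <;> by_cases h2 : k' ≤ d (x j')
    · exact hlowinj hk0 h1 hk0' h2 hww
    · exfalso
      have h3 := hslow h1
      have h4 := hshigh h2 (by omega)
      have h5 := hdlow h1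
      rw [hww, hdhigh h2 (by omega)] at h5
      rw [h5, ← hww, h3] at h4
      exact h.ne a h4.symm
    · exfalso
      have h3 := hshigh h1 (by omega)
      have h4 := hslow h2
      have h5 := hdlow h2
      rw [← hww, hdhigh h1 (by omega)] at h5
      rw [h5, hww, h4] at h3
      exact h.ne a h3.symm
    · have key : ∀ {j k}, ¬ k ≤ d (x j) → k ≤ 2 * d (x j) →
          w j k = ι (w j (2 * d (x j) + 1 - k)) := by
        intro j k h1 h2
        rw [hwhigh h1, hwlow (by omega),
          show k - d (x j) - 1 = d (x j) - (2 * d (x j) + 1 - k) by omega]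
      rw [key h1 hk, key h2 hk'] at hww
      have h3 := hlowinj (by omega) (by omega) (by omega) (by omega) (hinv hww)
      obtain ⟨rfl, h3⟩ := h3
      exact ⟨rfl, by omega⟩
  let l : Fin 3 → ℕ := fun j => 2 * d (x j) + 1
  have hl : ∀ j, l j = 2 * d (x j) + 1 := fun _ => rfl
  refine ⟨l, fun j => ⟨d (x j), rfl⟩, ?_⟩
  let φ : Bool ⊕ (Σ j : Fin 3, Fin (l j - 1)) → V(G) :=
    Sum.elim (fun b => bif b then ι a else a) fun v => w v.1 (v.2 + 1)
  have hφw : ∀ j (i : Fin (l j + 1)), φ (pathsVertex l j i) = w j i := by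
    intro j i
    rw [pathsVertex]
    split_ifs with h0 h1
    · rw [h0, hw0]; rfl
    · rw [h1, hl, hwl]; rfl
    · simp only [φ, Sum.elim_inr]
      congr 1
      omega
  have hφint : ∀ v : Σ j : Fin 3, Fin (l j - 1), d (φ (Sum.inr v)) ≠ 0 := by
    rintro ⟨j, i⟩
    have hi := i.2
    have hlj := hl j
    simp only [φ, Sum.elim_inr]
    by_cases h1 : (i : ℕ) + 1 ≤ d (x j)
    · rw [hdlow h1]; omega
    · rw [hdhigh h1 (by omega)]; omega
  have hφend : ∀ b, d (φ (Sum.inl b)) = 0 := by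
    rintro (_ | _)
    · exact h.depth_self
    · exact (h.depth_map a a).trans h.depth_self
  have hφ : φ.Injective := by
    rintro (b | ⟨j, i⟩) (b' | ⟨j', i'⟩) huv
    · cases b <;> cases b'
      · rfl
      · exact absurd huv.symm (h.ne a)
      · exact absurd huv (h.ne a)
      · rfl
    · exact absurd (by rw [← huv, hφend]) (hφint ⟨j', i'⟩)
    · exact absurd (by rw [huv, hφend]) (hφint ⟨j, i⟩)
    · have hi := i.2
      have hi' := i'.2
      have hlj := hl j
      have hlj' := hl j'
      have hww : w j (i + 1) = w j' (i' + 1) := huv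
      obtain ⟨rfl, h1⟩ := hwinj (Nat.succ_ne_zero i) (by omega) (Nat.succ_ne_zero i') (by omega) hww
      have : i = i' := Fin.ext (by omega)
      rw [this]
  have hedge : ∀ (j : Fin 3) (i : ℕ), i < l j → ∃ e : E(G), G.IsLink e (w j i) (w j (i + 1)) ∧
      (i = d (x j) → e.1 = f j) := by
    intro j i hi
    rw [hl] at hi
    have hpar : ∀ k < d (x j), 0 < G.mult (p^[d (x j) - k] (x j)) (p^[d (x j) - (k + 1)] (x j)) := by
      intro k hk
      have h1 : d (p^[d (x j) - (k + 1)] (x j)) = k + 1 := by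
        have h0 := hdlow (j := j) (k := k + 1) hk
        rwa [hwlow hk] at h0
      have h2 := (h.parent_spec (a := a) (x := p^[d (x j) - (k + 1)] (x j))
        (by rw [← hd_def]; omega)).1
      rw [← hp, ← Function.iterate_succ_apply' p] at h2
      rwa [show d (x j) - k = (d (x j) - (k + 1)).succ by omega]
    rcases lt_trichotomy i (d (x j)) with h1 | h1 | h1
    · rw [hwlow h1.le, hwlow h1]
      obtain ⟨e, he⟩ := mult_pos_iff.1 (hpar i h1)
      exact ⟨⟨e, he.edge_mem⟩, he, fun h2 => by omega⟩
    · refine ⟨⟨f j, (hx j).edge_mem⟩, ?_, fun _ => rfl⟩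
      rw [hwlow h1.le, hwhigh (by omega), h1, Nat.sub_self, Nat.add_sub_cancel_left, Nat.sub_self]
      exact hx j
    · rw [hwhigh (by omega), hwhigh (by omega)]
      have h2 := hpar (2 * d (x j) - i) (by omega)
      rw [← h.map, mult_comm] at h2
      obtain ⟨e, he⟩ := mult_pos_iff.1 h2
      refine ⟨⟨e, he.edge_mem⟩, ?_, fun h2 => by omega⟩
      rw [show i - d (x j) - 1 = d (x j) - (2 * d (x j) - i + 1) by omega,
        show i + 1 - d (x j) - 1 = d (x j) - (2 * d (x j) - i) by omega]
      exact he
  let ends : (Σ j : Fin 3, Fin (l j)) → (Bool ⊕ (Σ j : Fin 3, Fin (l j - 1))) ×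
      (Bool ⊕ (Σ j : Fin 3, Fin (l j - 1))) :=
    fun e => (pathsVertex l e.1 e.2.castSucc, pathsVertex l e.1 e.2.succ)
  choose ψ hψl hψf using fun e : Σ j : Fin 3, Fin (l j) => hedge e.1 e.2 e.2.2
  have hlink : ∀ e, G.IsLink (ψ e) (φ (ends e).1) (φ (ends e).2) := by
    intro e
    simp only [ends, hφw]
    exact hψl e
  have hψ : ψ.Injective := by
    rintro ⟨j, i⟩ ⟨j', i'⟩ hee
    have h1 := hψl ⟨j, i⟩
    rw [hee] at h1
    have h2 := h1.eq_and_eq_or_eq_and_eq (hψl ⟨j', i'⟩)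
    simp only [← Subtype.ext_iff] at h2
    have hi := i.2
    have hi' := i'.2
    have hlj := hl j
    have hlj' := hl j'
    have hdep : ∀ {j k}, k ≤ 2 * d (x j) + 1 →
        d (w j k) = if k ≤ d (x j) then k else 2 * d (x j) + 1 - k := by
      intro j k hk
      split_ifs with h1
      exacts [hdlow h1, hdhigh h1 hk]
    have e1 := hdep (j := j) (k := i) (by omega)
    have e2 := hdep (j := j) (k := i + 1) (by omega)
    have e3 := hdep (j := j') (k := i') (by omega)
    have e4 := hdep (j := j') (k := i' + 1) (by omega)
    have hdd : (d (w j i) = d (w j' i') ∧ d (w j (i + 1)) = d (w j' (i' + 1))) ∨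
        (d (w j i) = d (w j' (i' + 1)) ∧ d (w j (i + 1)) = d (w j' i')) := by
      rcases h2 with ⟨h3, h4⟩ | ⟨h3, h4⟩
      · left; rw [h3, h4]; exact ⟨rfl, rfl⟩
      · right; rw [h3, h4]; exact ⟨rfl, rfl⟩
    by_cases hc : (i : ℕ) = d (x j)
    · have hc' : (i' : ℕ) = d (x j') := by
        split_ifs at e1 e2 e3 e4 <;> omega
      have h3 := hψf ⟨j, i⟩ hc
      have h4 := hψf ⟨j', i'⟩ hc'
      obtain rfl : j = j' := hf (by rw [← h3, ← h4, hee])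
      have : i = i' := Fin.ext (by omega)
      rw [this]
    · have hc' : (i' : ℕ) ≠ d (x j') := fun hc' => by
        split_ifs at e1 e2 e3 e4 <;> omega
      -- compare the ends farther from the root
      have hfar : ∀ (j : Fin 3) (i : ℕ), i ≤ 2 * d (x j) → i ≠ d (x j) →
          ∃ k n, k ≠ 0 ∧ k ≤ 2 * d (x j) ∧ d (w j n) < d (w j k) ∧
            ((k = i + 1 ∧ n = i ∧ i < d (x j)) ∨ (k = i ∧ n = i + 1 ∧ d (x j) < i)) := by
        intro j i hi hne
        have e1 := hdep (j := j) (k := i) (by omega)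
        have e2 := hdep (j := j) (k := i + 1) (by omega)
        rcases lt_or_gt_of_ne hne with hlt | hlt
        · rw [if_pos (by omega)] at e1 e2
          exact ⟨i + 1, i, by omega, by omega, by omega, Or.inl ⟨rfl, rfl, hlt⟩⟩
        · rw [if_neg (by omega)] at e1 e2
          exact ⟨i, i + 1, by omega, by omega, by omega, Or.inr ⟨rfl, rfl, hlt⟩⟩
      obtain ⟨k, n, hk0, hk, hlt, hkn⟩ := hfar j i (by omega) hc
      obtain ⟨k', n', hk0', hk', hlt', hkn'⟩ := hfar j' i' (by omega) hc'
      have hww : w j k = w j' k' := by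
        clear e1 e2 e3 e4 hdd
        rcases hkn with ⟨rfl, rfl, -⟩ | ⟨rfl, rfl, -⟩ <;>
          rcases hkn' with ⟨rfl, rfl, -⟩ | ⟨rfl, rfl, -⟩ <;>
          rcases h2 with ⟨h3, h4⟩ | ⟨h3, h4⟩ <;>
          first | exact h3 | exact h4 | (exfalso; rw [h3, h4] at hlt; omega)
      obtain ⟨rfl, rfl⟩ := hwinj hk0 hk hk0' hk' hww
      have : i = i' := Fin.ext (by omega)
      rw [this]
  refine isIsomorphic_ofEnds_of_injective (ends := ends) hφ hψ hlink (Sum.inl false) h.induction ?_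
  have hcard : ∀ i : ∀ j, Fin (l j), 3 ≤ (Finset.univ.image
      fun j => (⟨j, i j⟩ : Σ j : Fin 3, Fin (l j))).card := fun i => by
    rw [Finset.card_image_of_injective _ fun j j' hj => congrArg Sigma.fst hj]
    simp
  rintro (b | ⟨j, i⟩)
  · cases b
    · refine ⟨_, ?_, ha.le.trans (hcard fun j => ⟨0, by rw [hl]; omega⟩)⟩
      intro e he
      obtain ⟨j, -, rfl⟩ := Finset.mem_image.1 he
      left
      simp [ends, pathsVertex]
    · refine ⟨_, ?_, ((h.deg_map a).trans ha).le.trans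
        (hcard fun j => ⟨2 * d (x j), by rw [hl]; omega⟩)⟩
      intro e he
      obtain ⟨j, -, rfl⟩ := Finset.mem_image.1 he
      right
      simp [ends, pathsVertex, hl]
  · have hi := i.2
    refine ⟨{⟨j, ⟨i, by omega⟩⟩, ⟨j, ⟨i + 1, by omega⟩⟩}, ?_, ?_⟩
    · intro e he
      simp only [Finset.mem_insert, Finset.mem_singleton] at he
      rcases he with rfl | rfl
      · right
        have : (i : ℕ) + 1 ≠ l j := by omega
        simp [ends, pathsVertex, this]
      · left
        have : (i : ℕ) + 1 ≠ l j := by omega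
        simp [ends, pathsVertex, this]
    · rw [hd2 _ (hφint ⟨j, i⟩), Finset.card_pair]
      intro h1
      have := congrArg (fun e : Σ j : Fin 3, Fin (l j) => (e.2 : ℕ)) h1
      simp at this

end GenusTwo

section Forward

variable [Fintype V(G)] [Finite E(G)] [G.Loopless]

/-- The three families exhaust the hyperelliptic graphs without Weierstrass points. -/
theorem exists_isIsomorphic_of_no_weierstrassPoint (hG : G.IsEdgeConnected 2) (hh : G.IsHyperelliptic)
    (hW : ∀ x : V(G), ¬ G.IsWeierstrassPoint x) :
    (∃ n : ℕ, 3 ≤ n ∧ G.IsIsomorphic (Graph.bananaGraph n)) ∨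
      (∃ l : Fin 3 → ℕ, (∀ j, Odd (l j)) ∧ G.IsIsomorphic (Graph.pathsGraph l)) ∨
      (∃ l : ℕ, 1 ≤ l ∧ G.IsIsomorphic (Graph.phiGraph l)) := by
  classical
  obtain ⟨ι, hι, hdegW⟩ := exists_hyperellipticInvolution hh hW
  have hμ := hG.isTwoEdgeConnected
  have h := hι.isDoubleTree hμ
  have hdeg : ∀ x : V(G), 2 ≤ deg G.mult x := fun x => hμ.two_le_deg (h.ne x).symm
  obtain ⟨⟨a⟩, -⟩ := isEdgeConnected_two_iff.1 hG
  by_cases hV : ∃ a : V(G), ∀ x, x = a ∨ x = ι a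
  · obtain ⟨a, ha⟩ := hV
    exact Or.inl (exists_isIsomorphic_bananaGraph h hh.1 ha)
  push Not at hV
  rcases eq_or_lt_of_le hh.1 with hg | hg
  · right; left
    have hsum := two_mul_genus (G := G)
    obtain ⟨a, ha⟩ : ∃ a, 3 ≤ deg G.mult a := by
      by_contra! hcon
      rw [Finset.sum_eq_zero fun x _ => by
        have := hdeg x; have := hcon x; omega] at hsum
      omega
    have h1 := sum_deg_le hdeg {a, ι a}
    rw [Finset.sum_pair (h.ne a).symm, h.deg_map] at h1
    refine exists_isIsomorphic_pathsGraph h hh.1 (a := a) (by omega) fun x hx hx' => ?_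
    have h2 := sum_deg_le hdeg {x, a, ι a}
    rw [Finset.sum_insert (by simp [hx, hx']), Finset.sum_pair (h.ne a).symm, h.deg_map] at h2
    have := hdeg x
    omega
  · right; right
    exact exists_isIsomorphic_phiGraph h hdeg hdegW hg hV a

end Forward

end Graph

namespace Multiplicity

variable {V : Type*} [Fintype V] [DecidableEq V] {μ : V → V → ℕ}

/-! ### Divisor classes -/

/-- The class of a vertex in the Picard group. -/
def cls (μ : V → V → ℕ) (x : V) : (V → ℤ) ⧸ principal μ := QuotientAddGroup.mk' _ (pt x)

theorem mk_eq_zero_iff {D : V → ℤ} :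
    QuotientAddGroup.mk' (principal μ) D = 0 ↔ D ∈ principal μ :=
  QuotientAddGroup.eq_zero_iff D

/-- A sequence in a group each of whose inner terms is the mean of its neighbours is an arithmetic
progression. -/
theorem eq_add_nsmul_of_mean {A : Type*} [AddCommGroup A] {c : ℕ → A} {l : ℕ}
    (h : ∀ k, k + 1 < l → c (k + 1) + c (k + 1) = c k + c (k + 2)) :
    ∀ k ≤ l, c k = c 0 + (k : ℤ) • (c 1 - c 0) := by
  intro k
  induction k using Nat.strong_induction_on with
  | _ k ih =>
    intro hk
    match k, ih, hk with
    | 0, _, _ => simp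
    | 1, _, _ => simp
    | k + 2, ih, hk =>
      have h1 := h k (by omega)
      have h2 := ih k (by omega) (by omega)
      have h3 := ih (k + 1) (by omega) (by omega)
      have h4 : c (k + 2) = c (k + 1) + c (k + 1) - c k := by rw [h1]; abel
      rw [h4, h2, h3]
      push_cast
      module

/-- A proper non-empty set that can be left only through a trivalent vertex `a` contains `a`, and all
three edges at `a` leave it: otherwise two of them do, and after removing `a` from the set only one
edge would leave it. -/
theorem IsTwoEdgeConnected.three_le_outdeg (hμ : IsTwoEdgeConnected μ) {a w : V} {S : Finset V}
    (ha : deg μ a = 3) (hS : S.Nonempty) (hw : w ∉ S) (h : ∀ x ∈ S, x ≠ a → outdeg μ S x = 0) :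
    a ∈ S ∧ 3 ≤ outdeg μ S a := by
  have hcut := hμ.cut S hS ⟨w, by simpa using hw⟩
  have haS : a ∈ S := by
    by_contra haS
    rw [Finset.sum_eq_zero fun x hx => h x hx (by rintro rfl; exact haS hx)] at hcut
    omega
  refine ⟨haS, ?_⟩
  rw [Finset.sum_eq_single_of_mem a haS h] at hcut
  by_contra hlt
  have hsum : ∑ y ∈ S.erase a, μ a y = 1 := by
    have h1 := Finset.sum_add_sum_compl S (μ a)
    have h2 := Finset.add_sum_erase S (μ a) haS
    rw [hμ.self] at h2
    rw [← deg, ha] at h1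
    rw [outdeg] at *
    omega
  have hne : (S.erase a).Nonempty := by
    rw [Finset.nonempty_iff_ne_empty]
    intro h0
    rw [h0] at hsum
    simp at hsum
  have hcut' := hμ.cut (S.erase a) hne ⟨a, by simp⟩
  have hout : ∀ x ∈ S.erase a, outdeg μ (S.erase a) x = μ a x := fun x hx => by
    have h1 := h x (Finset.mem_of_mem_erase hx) (Finset.ne_of_mem_erase hx)
    rw [outdeg] at h1 ⊢
    rw [Finset.compl_erase, Finset.sum_insert (by simpa using haS), h1, hμ.symm]
    rfl
  rw [Finset.sum_congr rfl hout, hsum] at hcut'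
  omega

end Multiplicity

namespace Graph

open Multiplicity

variable {α β : Type*} {G : Graph α β}

section Criteria

variable [Fintype V(G)] [DecidableEq V(G)] [Finite E(G)] [G.Loopless]

/-- If exactly two edges cross the boundary of `S`, then firing `S` moves a chip along both. -/
theorem cls_add_cls_eq {S : Finset V(G)} {e e' : β} {x y x' y' : V(G)} (hne : e ≠ e')
    (he : G.IsLink e x y) (he' : G.IsLink e' x' y') (hx : x ∈ S) (hx' : x' ∈ S) (hy : y ∉ S)
    (hy' : y' ∉ S) (h : ∀ f, G.Crosses S f → f = e ∨ f = e') :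
    cls G.mult x + cls G.mult x' = cls G.mult y + cls G.mult y' := by
  have hmem : pt x + pt x' - pt y - pt y' ∈ Multiplicity.principal G.mult := by
    refine indicator_mem_principal mult_comm hx hx' hy hy' fun u hu v hv => ?_
    have key : ∀ {e : β} {x y : V(G)}, G.IsLink e x y → x ∈ S → y ∉ S →
        (G.IsLink e u v ↔ u = x ∧ v = y) := by
      intro e x y he hx hy
      rw [he.isLink_iff]
      simp only [← Subtype.ext_iff]
      constructor
      · rintro (⟨rfl, rfl⟩ | ⟨rfl, rfl⟩)
        · exact ⟨rfl, rfl⟩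
        · exact absurd hx hv
      · rintro ⟨rfl, rfl⟩
        exact Or.inl ⟨rfl, rfl⟩
    have hset : {f | G.IsLink f u v} = {f | (f = e ∧ u = x ∧ v = y) ∨ (f = e' ∧ u = x' ∧ v = y')} := by
      ext f
      constructor
      · intro hf
        rcases h f ⟨u, hu, v, hv, hf⟩ with rfl | rfl
        · exact Or.inl ⟨rfl, (key he hx hy).1 hf⟩
        · exact Or.inr ⟨rfl, (key he' hx' hy').1 hf⟩
      · rintro (⟨rfl, huv⟩ | ⟨rfl, huv⟩)
        · exact (key he hx hy).2 huv
        · exact (key he' hx' hy').2 huv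
    rw [mult, hset]
    simp only [pt_apply]
    by_cases h1 : u = x ∧ v = y <;> by_cases h2 : u = x' ∧ v = y'
    · have : {f | (f = e ∧ u = x ∧ v = y) ∨ (f = e' ∧ u = x' ∧ v = y')} = {e, e'} := by
        ext f
        simp only [Set.mem_ofPred_eq, Set.mem_insert_iff, Set.mem_singleton_iff]
        tauto
      rw [this, Set.ncard_pair hne, if_pos h1.1, if_pos h1.2, if_pos h2.1, if_pos h2.2]
      norm_num
    · have : {f | (f = e ∧ u = x ∧ v = y) ∨ (f = e' ∧ u = x' ∧ v = y')} = {e} := by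
        ext f
        simp only [Set.mem_ofPred_eq, Set.mem_singleton_iff]
        tauto
      rw [this, Set.ncard_singleton, if_pos h1.1, if_pos h1.2]
      rcases not_and_or.1 h2 with h | h <;> simp [h]
    · have : {f | (f = e ∧ u = x ∧ v = y) ∨ (f = e' ∧ u = x' ∧ v = y')} = {e'} := by
        ext f
        simp only [Set.mem_ofPred_eq, Set.mem_singleton_iff]
        tauto
      rw [this, Set.ncard_singleton, if_pos h2.1, if_pos h2.2]
      rcases not_and_or.1 h1 with h | h <;> simp [h]
    · have : {f | (f = e ∧ u = x ∧ v = y) ∨ (f = e' ∧ u = x' ∧ v = y')} = ∅ := by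
        ext f
        simp only [Set.mem_ofPred_eq, Set.mem_empty_iff_false]
        tauto
      rw [this, Set.ncard_empty]
      rcases not_and_or.1 h1 with h | h <;> rcases not_and_or.1 h2 with h' | h' <;> simp [h, h']
  rw [← mk_eq_zero_iff, map_sub, map_sub, map_add, sub_sub, sub_eq_zero] at hmem
  exact hmem

/-- If every vertex can be completed to a pair in the class of `a + b`, then `a + b` has rank one. -/
theorem isHyperelliptic_of_pairs (hG : IsTwoEdgeConnected G.mult) (hg : 2 ≤ G.genus) {a b : V(G)}
    (hab : a ≠ b)
    (h : ∀ v, ∃ v', cls G.mult v + cls G.mult v' = cls G.mult a + cls G.mult b) :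
    G.IsHyperelliptic := by
  have : Nonempty V(G) := ⟨a⟩
  have hdeg : Divisor.degree (pt a + pt b : Divisor G) = 2 := by
    simp [Divisor.degree, Finset.sum_add_distrib, sum_pt]
  refine ⟨hg, pt a + pt b, hdeg, le_antisymm (Divisor.rank_le_one hG hab hdeg) ?_⟩
  refine Divisor.one_le_rank_iff.2 fun v => ?_
  obtain ⟨v', hv⟩ := h v
  refine ⟨pt v', pt_nonneg v', ?_⟩
  rw [← mk_eq_zero_iff, map_sub, map_sub, map_add]
  simp only [cls] at hv
  rw [← hv]
  abel

/-- If `g x - v` is equivalent to a divisor `D` such that firing any set of vertices creates a debt,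
then `x` is not a Weierstrass point. -/
theorem not_isWeierstrassPoint {x v : V(G)} (D : V(G) → ℤ)
    (hD : ∀ S : Finset V(G), S.Nonempty → ∃ y ∈ S, D y < outdeg G.mult S y)
    (h : G.genus • cls G.mult x - cls G.mult v = QuotientAddGroup.mk' _ D) :
    ¬ G.IsWeierstrassPoint x := by
  have : Nonempty V(G) := ⟨x⟩
  intro hx
  rw [IsWeierstrassPoint, Divisor.one_le_rank_iff, Divisor.point_eq_pt] at hx
  obtain ⟨E, hE, hEx⟩ := hx v
  have hED : E - D ∈ Multiplicity.principal G.mult := by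
    rw [← mk_eq_zero_iff] at hEx ⊢
    rw [map_sub, ← h]
    rw [map_sub, map_sub, map_zsmul] at hEx
    exact hEx
  obtain ⟨S, hS, hle⟩ := exists_legal_set hE hED
  obtain ⟨y, hy, hlt⟩ := hD S hS
  have := hle y hy
  omega

/-- On a graph of genus two, `x` is not a Weierstrass point if `2 x - b` is equivalent to `2 a - w`
for a trivalent vertex `a ≠ w`. -/
theorem not_isWeierstrassPoint_of_genus_two (hG : IsTwoEdgeConnected G.mult) (hg : G.genus = 2)
    {a b x w : V(G)} (ha : deg G.mult a = 3) (hw : w ≠ a)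
    (h : cls G.mult x + cls G.mult x + cls G.mult w = cls G.mult a + cls G.mult a + cls G.mult b) :
    ¬ G.IsWeierstrassPoint x := by
  refine not_isWeierstrassPoint (v := b) (pt a + pt a - pt w) (fun S hS => ?_) ?_
  · by_contra! hle
    have hD : ∀ y, (pt a + pt a - pt w : V(G) → ℤ) y =
        (if y = a then 2 else 0) - if y = w then 1 else 0 := fun y => by
      simp only [Pi.sub_apply, Pi.add_apply, pt_apply]
      split_ifs <;> omega
    have hwS : w ∉ S := fun hwS => by
      have := hle w hwS
      rw [hD, if_neg hw, if_pos rfl] at this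
      omega
    have h3 := hG.three_le_outdeg ha hS hwS fun y hy hya => by
      have := hle y hy
      rw [hD, if_neg hya] at this
      split_ifs at this <;> omega
    have := hle a h3.1
    rw [hD, if_pos rfl, if_neg hw.symm] at this
    omega
  · rw [hg, map_sub, map_add]
    simp only [cls] at h ⊢
    rw [two_zsmul, sub_eq_sub_iff_add_eq_add]
    exact h

theorem iff_of_le {u : ℕ → Prop} {m n : ℕ} (hmn : m ≤ n)
    (h : ∀ i, m ≤ i → i < n → (u i ↔ u (i + 1))) : u m ↔ u n := by
  induction n, hmn using Nat.le_induction with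
  | base => rfl
  | succ n hmn ih => exact (ih fun i h1 h2 => h i h1 (by omega)).trans (h n hmn (by omega))

end Criteria

/-! ### The three families have the required properties -/

section Families

variable [Fintype V(G)] [Finite E(G)] [G.Loopless]

/-- The divisor `a + b` has rank one, and `(n - 1) a - b` is not equivalent to an effective divisor
because all `n` edges leave `{a}`. -/
theorem isHyperelliptic_and_no_weierstrassPoint_of_bananaGraph {n : ℕ} (hn : 3 ≤ n)
    (h : G.IsIsomorphic (bananaGraph n)) :
    G.IsEdgeConnected 2 ∧ G.IsHyperelliptic ∧ ∀ x : V(G), ¬ G.IsWeierstrassPoint x := by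
  classical
  rw [bananaGraph_eq_ofEnds] at h
  obtain ⟨φ, ψ, hlink⟩ := h.exists_equiv
  have hV : Nat.card V(G) = 2 := by rw [← Nat.card_congr φ]; simp
  have hE : Nat.card E(G) = n := by rw [← Nat.card_congr ψ]; simp
  have hg : G.genus = n - 1 := by
    rw [genus, ← Nat.card_coe_set_eq, ← Nat.card_coe_set_eq, hV, hE]
    push_cast
    ring
  have hlink' : ∀ i b, G.IsLink (ψ i) (φ b) (φ !b) := by
    rintro i (_ | _)
    · exact hlink i
    · exact (hlink i).symm
  have hconn : G.IsEdgeConnected 2 := by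
    refine isEdgeConnected_two_iff.2 ⟨⟨φ false⟩, fun S ⟨x, hx⟩ ⟨y, hy⟩ => ?_⟩
    obtain ⟨b, rfl⟩ := φ.surjective x
    obtain ⟨b', rfl⟩ := φ.surjective y
    have hb : b' = !b := by
      cases b <;> cases b' <;> first | rfl | exact absurd hx hy
    subst hb
    refine ⟨ψ ⟨0, by omega⟩, ψ ⟨1, by omega⟩, ?_, ⟨_, hx, _, hy, hlink' _ b⟩,
      ⟨_, hx, _, hy, hlink' _ b⟩⟩
    intro h01
    have h2 := ψ.injective (Subtype.ext h01)
    simp at h2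
  have hμ := hconn.isTwoEdgeConnected
  refine ⟨hconn, isHyperelliptic_of_pairs hμ (by omega) (a := φ false) (b := φ true)
    (fun h => by simpa using φ.injective h) fun v => ?_, fun x => ?_⟩
  · obtain ⟨b, rfl⟩ := φ.surjective v
    refine ⟨φ !b, ?_⟩
    cases b
    · rfl
    · exact add_comm _ _
  · obtain ⟨b, rfl⟩ := φ.surjective x
    have hne : φ b ≠ φ !b := fun h => by simpa using φ.injective h
    refine not_isWeierstrassPoint (v := φ !b) (G.genus • pt (φ b) - pt (φ !b)) (fun S hS => ?_) ?_
    · by_contra! hle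
      have h1 : φ (!b) ∉ S := fun h1 => by
        have := hle _ h1
        simp [pt_apply, hne.symm] at this
        omega
      have hS' : S = {φ b} := by
        refine Finset.eq_singleton_iff_nonempty_unique_mem.2 ⟨hS, fun y hy => ?_⟩
        obtain ⟨b', rfl⟩ := φ.surjective y
        cases b <;> cases b' <;> first | rfl | exact absurd hy h1
      subst hS'
      have h2 := hle (φ b) (by simp)
      have h3 : n ≤ outdeg G.mult {φ b} (φ b) := by
        have h4 : n ≤ G.mult (φ b) (φ !b) := by
          rw [mult, ← hE, ← Set.ncard_univ, ← Set.ncard_image_of_injective _ Subtype.val_injective]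
          refine Set.ncard_le_ncard ?_ (finite_setOf_isLink _ _)
          rintro _ ⟨e, -, rfl⟩
          obtain ⟨i, rfl⟩ := ψ.surjective e
          exact hlink' i b
        refine h4.trans (Finset.single_le_sum (f := G.mult (φ b)) (fun _ _ => Nat.zero_le _) ?_)
        simp
      simp [pt_apply, hne] at h2
      omega
    · rw [map_sub, map_zsmul]
      rfl

/-- The two vertices at the same distance from the two ends of a path form a pair in the class of
`a + b`. For the vertex number `k` of a path of length `l`, the divisor `2 x_k - b` is equivalent to
`2 a - x_{l - 2k}` if `2 k < l`, and symmetrically otherwise; `2 k = l` is excluded by parity. -/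
theorem isHyperelliptic_and_no_weierstrassPoint_of_pathsGraph {l : Fin 3 → ℕ}
    (hl : ∀ j, Odd (l j)) (h : G.IsIsomorphic (pathsGraph l)) :
    G.IsEdgeConnected 2 ∧ G.IsHyperelliptic ∧ ∀ x : V(G), ¬ G.IsWeierstrassPoint x := by
  classical
  obtain ⟨φ, ψ, hlink⟩ := IsIsomorphic.exists_equiv h
  have hpos : ∀ j, 0 < l j := fun j => (hl j).pos
  -- the vertex number `k` of the path with index `j`
  let P : Fin 3 → ℕ → V(G) := fun j k => if hk : k < l j + 1 then φ (pathsVertex l j ⟨k, hk⟩)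
    else φ (Sum.inl false)
  set a := φ (Sum.inl false) with ha_def
  set b := φ (Sum.inl true) with hb_def
  have hab : a ≠ b := fun h => by simpa using φ.injective h
  have hP : ∀ {j k} (hk : k < l j + 1), P j k = φ (pathsVertex l j ⟨k, hk⟩) := fun hk => dif_pos hk
  have hP0 : ∀ j, P j 0 = a := fun j => by rw [hP (Nat.succ_pos _)]; simp [pathsVertex, ha_def]
  have hPl : ∀ j, P j (l j) = b := fun j => by
    rw [hP (Nat.lt_succ_self _)]
    simp [pathsVertex, hb_def, (hpos j).ne']
  have hPint : ∀ {j k} (h0 : k ≠ 0) (hk : k < l j),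
      P j k = φ (Sum.inr ⟨j, ⟨k - 1, by omega⟩⟩) := fun {j k} h0 hk => by
    rw [hP (by omega)]
    simp [pathsVertex, h0, hk.ne]
  have hlink' : ∀ j (i : Fin (l j)), G.IsLink (ψ ⟨j, i⟩) (P j i) (P j (i + 1)) := fun j i => by
    rw [hP (by omega), hP (by omega)]
    exact hlink ⟨j, i⟩
  have hsurj : ∀ v, ∃ j, ∃ k ≤ l j, v = P j k := by
    intro v
    obtain ⟨(_ | _) | ⟨j, i⟩, rfl⟩ := φ.surjective v
    · exact ⟨0, 0, Nat.zero_le _, (hP0 0).symm⟩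
    · exact ⟨0, l 0, le_rfl, (hPl 0).symm⟩
    · refine ⟨j, i + 1, by omega, ?_⟩
      rw [hPint (by omega) (by omega)]
      rfl
  have hsurjE : ∀ {x y : α} {e}, G.IsLink e x y → ∃ j i, e = ψ ⟨j, i⟩ := fun {x y e} he => by
    obtain ⟨⟨j, i⟩, hji⟩ := ψ.surjective ⟨e, he.edge_mem⟩
    exact ⟨j, i, by rw [hji]⟩
  have hinj : ∀ {j k j' k'}, k ≠ 0 → k < l j → k' ≤ l j' → P j k = P j' k' → j = j' ∧ k = k' := by
    intro j k j' k' h0 hk hk' hPP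
    rw [hPint h0 hk] at hPP
    by_cases h0' : k' = 0
    · rw [h0', hP0] at hPP
      simpa using φ.injective hPP
    by_cases hl' : k' = l j'
    · rw [hl', hPl] at hPP
      simpa using φ.injective hPP
    rw [hPint h0' (by omega)] at hPP
    have h1 := φ.injective hPP
    rw [Sum.inr.injEq, Sigma.mk.injEq] at h1
    obtain ⟨rfl, h1⟩ := h1
    rw [heq_eq_eq, Fin.mk.injEq] at h1
    exact ⟨rfl, by omega⟩
  have hV : Nat.card V(G) = 2 + ∑ j, (l j - 1) := by
    rw [← Nat.card_congr φ]; simp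
  have hE : Nat.card E(G) = ∑ j, l j := by
    rw [← Nat.card_congr ψ]; simp
  have hg : G.genus = 2 := by
    rw [genus, ← Nat.card_coe_set_eq, ← Nat.card_coe_set_eq, hV, hE, Fin.sum_univ_three,
      Fin.sum_univ_three]
    have := hpos 0
    have := hpos 1
    have := hpos 2
    omega
  have hconn : G.IsEdgeConnected 2 := by
    refine isEdgeConnected_two_iff.2 ⟨⟨a⟩, fun S ⟨x, hx⟩ ⟨y, hy⟩ => ?_⟩
    by_contra hcon
    have hunique : ∀ e e', G.Crosses S e → G.Crosses S e' → e = e' := fun e e' he he' => by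
      by_contra hne
      exact hcon ⟨e, e', hne, he, he'⟩
    have hstep : ∀ j (i : Fin (l j)), ¬ G.Crosses S (ψ ⟨j, i⟩) → (P j i ∈ S ↔ P j (i + 1) ∈ S) := by
      intro j i hnc
      by_contra hiff
      rcases not_iff.1 hiff with h1
      by_cases h2 : P j i ∈ S
      · exact hnc ⟨_, h2, _, by tauto, hlink' j i⟩
      · exact hnc ⟨_, h1.1 h2, _, h2, (hlink' j i).symm⟩
    -- a path without crossing edge shows that both ends are on the same side
    have hpath : ∀ j, (∀ i, ¬ G.Crosses S (ψ ⟨j, i⟩)) → ∀ k ≤ l j, (a ∈ S ↔ P j k ∈ S) := by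
      intro j hj k hk
      rw [← hP0 j]
      exact iff_of_le (u := fun k => P j k ∈ S) (Nat.zero_le k) fun i _ hi =>
        hstep j ⟨i, by omega⟩ (hj _)
    have hall : ∀ v, a ∈ S ↔ v ∈ S := by
      by_cases hex : ∃ j₀ i₀, G.Crosses S (ψ ⟨j₀, i₀⟩)
      · obtain ⟨j₀, i₀, h0⟩ := hex
        have hnc : ∀ j (i : Fin (l j)), (j ≠ j₀ ∨ (i : ℕ) ≠ i₀) → ¬ G.Crosses S (ψ ⟨j, i⟩) := by
          intro j i hji hc
          have h1 := ψ.injective (Subtype.ext (hunique _ _ hc h0))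
          rw [Sigma.mk.injEq] at h1
          obtain ⟨rfl, h1⟩ := h1
          rw [heq_eq_eq] at h1
          subst h1
          tauto
        obtain ⟨j₁, hj₁⟩ : ∃ j₁ : Fin 3, j₁ ≠ j₀ := exists_ne j₀
        have habS : a ∈ S ↔ b ∈ S := by
          rw [← hPl j₁]
          exact hpath j₁ (fun i => hnc _ _ (Or.inl hj₁)) _ le_rfl
        intro v
        obtain ⟨j, k, hk, rfl⟩ := hsurj v
        by_cases hj : j = j₀
        · subst hj
          by_cases hki : k ≤ i₀
          · rw [← hP0 j]
            exact iff_of_le (u := fun k => P j k ∈ S) (Nat.zero_le k) fun i _ hi =>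
              hstep j ⟨i, by omega⟩ (hnc _ _ (Or.inr (by simp; omega)))
          · rw [habS, ← hPl j]
            exact (iff_of_le (u := fun k => P j k ∈ S) hk fun i hi hi' =>
              hstep j ⟨i, by omega⟩ (hnc _ _ (Or.inr (by simp; omega)))).symm
        · exact hpath j (fun i => hnc _ _ (Or.inl hj)) k hk
      · push Not at hex
        intro v
        obtain ⟨j, k, hk, rfl⟩ := hsurj v
        exact hpath j (hex j) k hk
    exact hy ((hall y).1 ((hall x).2 hx))
  have hμ := hconn.isTwoEdgeConnected
  -- firing an inner vertex shows that the classes along each path form an arithmetic progression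
  have hmean : ∀ j k, k + 1 < l j → cls G.mult (P j (k + 1)) + cls G.mult (P j (k + 1)) =
      cls G.mult (P j k) + cls G.mult (P j (k + 2)) := by
    intro j k hk
    have hne : ∀ j' k', k' ≤ l j' → P j (k + 1) = P j' k' → j = j' ∧ k + 1 = k' :=
      fun j' k' hk' => hinj (by omega) hk hk'
    refine cls_add_cls_eq (S := {P j (k + 1)}) (e := ψ ⟨j, ⟨k, by omega⟩⟩)
      (e' := ψ ⟨j, ⟨k + 1, hk⟩⟩) ?_ (hlink' j ⟨k, by omega⟩).symm (hlink' j ⟨k + 1, hk⟩)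
      (by simp) (by simp) ?_ ?_ ?_
    · intro h1
      have h2 := ψ.injective (Subtype.ext h1)
      simp at h2
    · intro h1
      have := (hne j k (by omega) (Finset.mem_singleton.1 h1).symm).2
      omega
    · intro h1
      have := (hne j (k + 2) (by omega) (Finset.mem_singleton.1 h1).symm).2
      omega
    · rintro f ⟨u, hu, v, hv, hf⟩
      obtain ⟨j', i, rfl⟩ := hsurjE hf
      rw [Finset.mem_coe, Finset.mem_singleton] at hu
      subst hu
      rcases hf.left_eq_or_eq (hlink' j' i) with h1 | h1
      · obtain ⟨rfl, h2⟩ := hne _ _ (by omega) (Subtype.ext h1)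
        right
        congr
        exact Fin.ext h2.symm
      · obtain ⟨rfl, h2⟩ := hne _ _ (by omega) (Subtype.ext h1)
        left
        congr
        exact Fin.ext (by simp; omega)
  have hap : ∀ j, ∃ δ, ∀ k ≤ l j, cls G.mult (P j k) = cls G.mult a + (k : ℤ) • δ := fun j => by
    have := eq_add_nsmul_of_mean (c := fun k => cls G.mult (P j k)) (hmean j)
    simp only [hP0] at this
    exact ⟨_, this⟩
  have hdega : deg G.mult a = 3 := by
    have : {e : E(G) | G.Inc e a} = Set.range fun j => ψ ⟨j, ⟨0, hpos j⟩⟩ := by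
      ext e
      constructor
      · rintro ⟨v, hv⟩
        obtain ⟨⟨j, i⟩, rfl⟩ := ψ.surjective e
        refine ⟨j, ?_⟩
        rcases hv.left_eq_or_eq (hlink' j i) with h1 | h1
        · by_cases h0 : (i : ℕ) = 0
          · have hi : i = ⟨0, hpos j⟩ := Fin.ext h0
            rw [hi]
          · have := hinj h0 i.2 (Nat.zero_le _) ((Subtype.ext h1.symm).trans (hP0 j).symm)
            omega
        · by_cases h0 : (i : ℕ) + 1 = l j
          · rw [h0, hPl] at h1
            exact absurd (Subtype.ext h1) hab
          · have := hinj (by omega) (by omega) (Nat.zero_le _)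
              ((Subtype.ext h1.symm).trans (hP0 j).symm)
            omega
      · rintro ⟨j, rfl⟩
        have := (hlink' j ⟨0, hpos j⟩).inc_left
        rw [hP0] at this
        exact this
    rw [deg_eq_ncard, this, ← Set.image_univ, Set.ncard_image_of_injective, Set.ncard_univ]
    · simp
    · intro j j' hjj
      exact congrArg Sigma.fst (ψ.injective hjj)
  have hdegb : deg G.mult b = 3 := by
    have : {e : E(G) | G.Inc e b} =
        Set.range fun j => ψ ⟨j, ⟨l j - 1, by have := hpos j; omega⟩⟩ := by
      ext e
      constructor
      · rintro ⟨v, hv⟩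
        obtain ⟨⟨j, i⟩, rfl⟩ := ψ.surjective e
        refine ⟨j, ?_⟩
        rcases hv.left_eq_or_eq (hlink' j i) with h1 | h1
        · by_cases h0 : (i : ℕ) = 0
          · rw [h0, hP0] at h1
            exact absurd (Subtype.ext h1) hab.symm
          · have := hinj h0 i.2 le_rfl ((Subtype.ext h1.symm).trans (hPl j).symm)
            omega
        · by_cases h0 : (i : ℕ) + 1 = l j
          · have hi : i = ⟨l j - 1, by omega⟩ := Fin.ext (Nat.eq_sub_of_add_eq h0)
            rw [hi]
          · have := hinj (by omega) (by omega) le_rfl ((Subtype.ext h1.symm).trans (hPl j).symm)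
            omega
      · rintro ⟨j, rfl⟩
        have h1 := hpos j
        have := (hlink' j ⟨l j - 1, by omega⟩).inc_right
        simp only [Nat.sub_add_cancel h1, hPl] at this
        exact this
    rw [deg_eq_ncard, this, ← Set.image_univ, Set.ncard_image_of_injective, Set.ncard_univ]
    · simp
    · intro j j' hjj
      exact congrArg Sigma.fst (ψ.injective hjj)
  refine ⟨hconn, isHyperelliptic_of_pairs hμ hg.ge hab fun v => ?_, fun x => ?_⟩
  · obtain ⟨j, k, hk, rfl⟩ := hsurj v
    obtain ⟨δ, hδ⟩ := hap j
    refine ⟨P j (l j - k), ?_⟩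
    have hb := hδ (l j) le_rfl
    rw [hPl] at hb
    rw [hδ k hk, hδ _ (Nat.sub_le _ _), hb, Nat.cast_sub hk]
    module
  · obtain ⟨j, k, hk, rfl⟩ := hsurj x
    obtain ⟨δ, hδ⟩ := hap j
    have hb := hδ (l j) le_rfl
    rw [hPl] at hb
    obtain ⟨m, hm⟩ := hl j
    -- as the length is odd, the two chips never meet at the opposite end of the path
    by_cases h2 : 2 * k < l j
    · have hw : P j (l j - 2 * k) ≠ a := fun h => by
        by_cases h0 : k = 0
        · rw [h0, Nat.mul_zero, Nat.sub_zero, hPl] at h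
          exact hab h.symm
        · have := hinj (by omega) (by omega) (Nat.zero_le _) (h.trans (hP0 j).symm)
          omega
      refine not_isWeierstrassPoint_of_genus_two hμ hg (b := b) hdega hw ?_
      rw [hδ k hk, hδ _ (Nat.sub_le _ _), hb, Nat.cast_sub h2.le]
      push_cast
      module
    · have hw : P j (2 * (l j - k)) ≠ b := fun h => by
        by_cases h0 : k = l j
        · rw [h0, Nat.sub_self, Nat.mul_zero, hP0] at h
          exact hab h
        · have := hinj (by omega) (by omega) le_rfl (h.trans (hPl j).symm)
          omega
      refine not_isWeierstrassPoint_of_genus_two hμ hg (b := a) hdegb hw ?_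
      rw [hδ k hk, hδ (2 * (l j - k)) (by omega), hb]
      push_cast [Nat.cast_sub hk]
      module

/-- The pairs `x_k + y_k` are all equivalent. The divisor `3 x_i - y_l` is equivalent to
`x_0 + x_i + x_l - y_{2i}` if `2 i ≤ l`, and `3 x_i - y_0` to `x_0 + x_i + x_l - y_{2i - l}`
otherwise. -/
theorem isHyperelliptic_and_no_weierstrassPoint_of_phiGraph {l : ℕ} (hl : 1 ≤ l)
    (h : G.IsIsomorphic (phiGraph l)) :
    G.IsEdgeConnected 2 ∧ G.IsHyperelliptic ∧ ∀ x : V(G), ¬ G.IsWeierstrassPoint x := by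
  classical
  obtain ⟨φ, ψ, hlink⟩ := IsIsomorphic.exists_equiv h
  -- the vertex number `k` of the path with index `c`
  let P : Bool → ℕ → V(G) := fun c k => if hk : k < l + 1 then φ (c, ⟨k, hk⟩) else φ (c, 0)
  have hP : ∀ {c k} (hk : k < l + 1), P c k = φ (c, ⟨k, hk⟩) := fun hk => dif_pos hk
  have hinj : ∀ {c k c' k'}, k ≤ l → k' ≤ l → P c k = P c' k' → c = c' ∧ k = k' := by
    intro c k c' k' hk hk' hPP
    rw [hP (by omega), hP (by omega)] at hPP
    have h1 := φ.injective hPP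
    rw [Prod.mk.injEq, Fin.mk.injEq] at h1
    exact h1
  have hne : ∀ {c k c' k'}, k ≤ l → k' ≤ l → k ≠ k' → P c k ≠ P c' k' := fun hk hk' hkk hPP =>
    hkk (hinj hk hk' hPP).2
  have hnec : ∀ c {k k'}, k ≤ l → k' ≤ l → P c k ≠ P (!c) k' := fun c k k' hk hk' hPP => by
    have := (hinj hk hk' hPP).1
    cases c <;> simp at this
  have hsurj : ∀ v, ∃ c, ∃ k ≤ l, v = P c k := by
    intro v
    obtain ⟨⟨c, k⟩, rfl⟩ := φ.surjective v
    exact ⟨c, k, by omega, (hP k.2).symm⟩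
  have hlinkI : ∀ c (i : Fin l), G.IsLink (ψ (Sum.inl (c, i))) (P c i) (P c (i + 1)) := fun c i => by
    rw [hP (by omega), hP (by omega)]
    exact hlink (Sum.inl (c, i))
  have hlinkV : ∀ c c', G.IsLink (ψ (Sum.inr (c, c')))
      (P false (if c then l else 0)) (P true (if c then l else 0)) := by
    rintro (_ | _) c'
    · rw [hP (by simp), hP (by simp)]
      exact hlink (Sum.inr (false, c'))
    · rw [hP (by simp), hP (by simp)]
      exact hlink (Sum.inr (true, c'))
  have hV : Nat.card V(G) = 2 * (l + 1) := by rw [← Nat.card_congr φ]; simp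
  have hE : Nat.card E(G) = 2 * l + 4 := by rw [← Nat.card_congr ψ]; simp
  have hg : G.genus = 3 := by
    rw [genus, ← Nat.card_coe_set_eq, ← Nat.card_coe_set_eq, hV, hE]
    push_cast
    ring
  have hconn : G.IsEdgeConnected 2 := by
    refine isEdgeConnected_two_iff.2 ⟨⟨P false 0⟩, fun S ⟨x, hx⟩ ⟨y, hy⟩ => ?_⟩
    by_contra hcon
    have hunique : ∀ e e' : (Bool × Fin l) ⊕ (Bool × Bool), G.Crosses S (ψ e) →
        G.Crosses S (ψ e') → e = e' := fun e e' he he' => by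
      by_contra hne
      exact hcon ⟨_, _, fun h => hne (ψ.injective (Subtype.ext h)), he, he'⟩
    have hiff : ∀ {e : β} {x y : V(G)}, G.IsLink e x y → ¬ G.Crosses S e → (x ∈ S ↔ y ∈ S) := by
      intro e x y he hnc
      by_contra hiff
      rcases not_iff.1 hiff with h1
      by_cases h2 : x ∈ S
      · exact hnc ⟨x, h2, y, by tauto, he⟩
      · exact hnc ⟨y, h1.1 h2, x, h2, he.symm⟩
    -- parallel edges cannot cross
    have hend : ∀ c : Bool, P false (if c then l else 0) ∈ S ↔ P true (if c then l else 0) ∈ S := by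
      intro c
      by_contra hiff'
      have h1 : ∀ c', G.Crosses S (ψ (Sum.inr (c, c'))) := fun c' => by
        by_contra hnc
        exact hiff' (hiff (hlinkV c c') hnc)
      have h2 := hunique _ _ (h1 false) (h1 true)
      simp at h2
    have h0S : P false 0 ∈ S ↔ P true 0 ∈ S := hend false
    have hlS : P false l ∈ S ↔ P true l ∈ S := hend true
    have hpath : ∀ c, (∀ i, ¬ G.Crosses S (ψ (Sum.inl (c, i)))) →
        ∀ k ≤ l, (P c 0 ∈ S ↔ P c k ∈ S) := by
      intro c hc k hk
      exact iff_of_le (u := fun k => P c k ∈ S) (Nat.zero_le k) fun i _ hi =>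
        hiff (hlinkI c ⟨i, by omega⟩) (hc _)
    have hall : ∀ v, P false 0 ∈ S ↔ v ∈ S := by
      by_cases hex : ∃ c₀ i₀, G.Crosses S (ψ (Sum.inl (c₀, i₀)))
      · obtain ⟨c₀, i₀, h0⟩ := hex
        have hnc : ∀ c (i : Fin l), (c ≠ c₀ ∨ (i : ℕ) ≠ i₀) →
            ¬ G.Crosses S (ψ (Sum.inl (c, i))) := by
          intro c i hci hc
          have h1 := hunique _ _ hc h0
          rw [Sum.inl.injEq, Prod.mk.injEq, Fin.ext_iff] at h1
          tauto
        have h2 : ∀ k ≤ l, (P (!c₀) 0 ∈ S ↔ P (!c₀) k ∈ S) :=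
          hpath (!c₀) fun i => hnc _ _ (Or.inl (by cases c₀ <;> simp))
        have h3 : ∀ k ≤ l, (P c₀ 0 ∈ S ↔ P c₀ k ∈ S) := by
          intro k hk
          by_cases hki : k ≤ i₀
          · exact iff_of_le (u := fun k => P c₀ k ∈ S) (Nat.zero_le k) fun i _ hi =>
              hiff (hlinkI c₀ ⟨i, by omega⟩) (hnc _ _ (Or.inr (by simp; omega)))
          · have h4 : P c₀ k ∈ S ↔ P c₀ l ∈ S :=
              iff_of_le (u := fun k => P c₀ k ∈ S) hk fun i hi hi' =>
                hiff (hlinkI c₀ ⟨i, by omega⟩) (hnc _ _ (Or.inr (by simp; omega)))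
            have h5 := h2 l le_rfl
            cases c₀ <;> simp only [Bool.not_false, Bool.not_true] at h5 <;> tauto
        intro v
        obtain ⟨c, k, hk, rfl⟩ := hsurj v
        have h6 := h2 k hk
        have h7 := h3 k hk
        cases c₀ <;> cases c <;> simp only [Bool.not_false, Bool.not_true] at h6 <;> tauto
      · push Not at hex
        intro v
        obtain ⟨c, k, hk, rfl⟩ := hsurj v
        have h6 := hpath c (hex c) k hk
        cases c <;> tauto
    exact hy ((hall y).1 ((hall x).2 hx))
  have hμ := hconn.isTwoEdgeConnected
  have hcross : ∀ {S : Set V(G)} {e : β}, G.Crosses S e → ∃ e', e = ψ e' := by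
    rintro S e ⟨u, -, v, -, he⟩
    obtain ⟨e', he'⟩ := ψ.surjective ⟨e, he.edge_mem⟩
    exact ⟨e', by rw [he']⟩
  have hmean : ∀ c k, k + 1 < l → cls G.mult (P c (k + 1)) + cls G.mult (P c (k + 1)) =
      cls G.mult (P c k) + cls G.mult (P c (k + 2)) := by
    intro c k hk
    refine cls_add_cls_eq (S := {P c (k + 1)}) (e := ψ (Sum.inl (c, ⟨k, by omega⟩)))
      (e' := ψ (Sum.inl (c, ⟨k + 1, hk⟩))) ?_ (hlinkI c ⟨k, by omega⟩).symm (hlinkI c ⟨k + 1, hk⟩)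
      (by simp) (by simp) ?_ ?_ ?_
    · intro h1
      have h2 := ψ.injective (Subtype.ext h1)
      simp at h2
    · rw [Finset.mem_singleton]
      exact hne (by omega) (by omega) (by omega)
    · rw [Finset.mem_singleton]
      exact hne (c := c) (c' := c) (k := k + 1 + 1) hk (by omega) (by omega)
    · intro f hf
      obtain ⟨e, rfl⟩ := hcross hf
      obtain ⟨u, hu, v, hv, hf⟩ := hf
      rw [Finset.mem_coe, Finset.mem_singleton] at hu
      subst hu
      rcases e with ⟨c', i⟩ | ⟨c', c''⟩
      · rcases hf.left_eq_or_eq (hlinkI c' i) with h1 | h1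
        · obtain ⟨rfl, h2⟩ := hinj (by omega) (by omega) (Subtype.ext h1)
          right
          have hi : i = ⟨k + 1, hk⟩ := Fin.ext h2.symm
          rw [hi]
        · obtain ⟨rfl, h2⟩ := hinj (by omega) (by omega) (Subtype.ext h1)
          left
          have hi : i = ⟨k, by omega⟩ := Fin.ext (Nat.succ.inj h2.symm)
          rw [hi]
      · exfalso
        rcases hf.left_eq_or_eq (hlinkV c' c'') with h1 | h1
        · have := (hinj (by omega) (by split_ifs <;> omega) (Subtype.ext h1)).2
          split_ifs at this <;> omega
        · have := (hinj (by omega) (by split_ifs <;> omega) (Subtype.ext h1)).2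
          split_ifs at this <;> omega
  have hfirst : cls G.mult (P false 0) + cls G.mult (P true 0) =
      cls G.mult (P false 1) + cls G.mult (P true 1) := by
    refine cls_add_cls_eq (S := {P false 0, P true 0}) (e := ψ (Sum.inl (false, ⟨0, by omega⟩)))
      (e' := ψ (Sum.inl (true, ⟨0, by omega⟩))) ?_ (hlinkI false ⟨0, by omega⟩)
      (hlinkI true ⟨0, by omega⟩) (by simp) (by simp) ?_ ?_ ?_
    · intro h1
      have h2 := ψ.injective (Subtype.ext h1)
      simp at h2
    · rw [Finset.mem_insert, Finset.mem_singleton, not_or]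
      exact ⟨hne (by simpa using hl) (by omega) (by simp),
        hne (by simpa using hl) (by omega) (by simp)⟩
    · rw [Finset.mem_insert, Finset.mem_singleton, not_or]
      exact ⟨hne (by simpa using hl) (by omega) (by simp),
        hne (by simpa using hl) (by omega) (by simp)⟩
    · intro f hf
      obtain ⟨e, rfl⟩ := hcross hf
      obtain ⟨u, hu, v, hv, hf⟩ := hf
      have hmem : ∀ {c k}, k ≤ l →
          (P c k ∈ ((({P false 0, P true 0} : Finset V(G)) : Set V(G))) ↔ k = 0) := by
        intro c k hk
        rw [Finset.mem_coe, Finset.mem_insert, Finset.mem_singleton]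
        constructor
        · rintro (h1 | h1)
          · exact (hinj hk (Nat.zero_le _) h1).2
          · exact (hinj hk (Nat.zero_le _) h1).2
        · rintro rfl
          cases c <;> simp
      rcases e with ⟨c, i⟩ | ⟨c, c'⟩
      · have hi : (i : ℕ) = 0 := by
          rcases hf.eq_and_eq_or_eq_and_eq (hlinkI c i) with ⟨h1, h2⟩ | ⟨h1, h2⟩
          · rw [Subtype.ext h1, hmem (by omega)] at hu
            exact hu
          · rw [Subtype.ext h1, hmem (by omega)] at hu
            omega
        have hi' : i = ⟨0, by omega⟩ := Fin.ext hi
        rw [hi']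
        cases c
        · left; rfl
        · right; rfl
      · exfalso
        have hle : (if c then l else 0) ≤ l := by split_ifs <;> omega
        rcases hf.eq_and_eq_or_eq_and_eq (hlinkV c c') with ⟨h1, h2⟩ | ⟨h1, h2⟩
        · rw [Subtype.ext h1, hmem hle] at hu
          rw [Subtype.ext h2, hmem hle] at hv
          exact hv hu
        · rw [Subtype.ext h1, hmem hle] at hu
          rw [Subtype.ext h2, hmem hle] at hv
          exact hv hu
  have hap : ∃ δ, ∀ c, ∀ k ≤ l, cls G.mult (P c k) =
      cls G.mult (P c 0) + (k : ℤ) • (if c then -δ else δ) := by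
    refine ⟨cls G.mult (P false 1) - cls G.mult (P false 0), fun c k hk => ?_⟩
    have h1 := eq_add_nsmul_of_mean (c := fun k => cls G.mult (P c k)) (hmean c) k hk
    cases c
    · exact h1
    · have h2 : cls G.mult (P true 1) = cls G.mult (P false 0) + cls G.mult (P true 0) -
          cls G.mult (P false 1) := by rw [hfirst]; abel
      simp only [h2] at h1
      rw [h1, if_pos rfl]
      congr 2
      abel
  obtain ⟨δ, hδ⟩ := hap
  have hδ' : ∀ c, ∀ k ≤ l, cls G.mult (P (!c) k) =
      cls G.mult (P (!c) 0) - (k : ℤ) • (if c then -δ else δ) := by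
    intro c k hk
    rw [hδ _ k hk]
    cases c <;> simp [sub_eq_add_neg]
  have hpar : ∀ c (b : Bool), 2 ≤ G.mult (P c (if b then l else 0)) (P (!c) (if b then l else 0)) := by
    intro c b
    have hcard : ({(ψ (Sum.inr (b, false))).1, (ψ (Sum.inr (b, true))).1} : Set β).ncard = 2 :=
      Set.ncard_pair fun h1 => by simpa using ψ.injective (Subtype.ext h1)
    rw [mult, ← hcard]
    refine Set.ncard_le_ncard ?_ (finite_setOf_isLink _ _)
    have h1 : ∀ c', G.IsLink (ψ (Sum.inr (b, c')))
        (P c (if b then l else 0)) (P (!c) (if b then l else 0)) := fun c' => by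
      cases c
      · exact hlinkV b c'
      · exact (hlinkV b c').symm
    rintro e (rfl | rfl)
    exacts [h1 _, h1 _]
  have hstep : ∀ c (i : Fin l), 0 < G.mult (P c i) (P c (i + 1)) := fun c i =>
    mult_pos_iff.2 ⟨_, hlinkI c i⟩
  have hdeg : ∀ c (b : Bool), deg G.mult (P c (if b then l else 0)) = 3 := by
    intro c b
    have hle : (if b then l else 0) ≤ l := by split_ifs <;> omega
    have : {e : E(G) | G.Inc e (P c (if b then l else 0))} =
        {ψ (Sum.inl (c, ⟨if b then l - 1 else 0, by split_ifs <;> omega⟩)),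
          ψ (Sum.inr (b, false)), ψ (Sum.inr (b, true))} := by
      ext e
      obtain ⟨e, rfl⟩ := ψ.surjective e
      simp only [Set.mem_ofPred_eq, Set.mem_insert_iff, Set.mem_singleton_iff, ψ.injective.eq_iff]
      constructor
      · rintro ⟨v, hv⟩
        rcases e with ⟨c', i⟩ | ⟨b', c'⟩
        · left
          rw [Sum.inl.injEq, Prod.mk.injEq, Fin.ext_iff]
          rcases hv.left_eq_or_eq (hlinkI c' i) with h1 | h1
          · obtain ⟨rfl, h2⟩ := hinj hle (by omega) (Subtype.ext h1)
            cases b <;> simp at h2 ⊢ <;> omega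
          · obtain ⟨rfl, h2⟩ := hinj hle (by omega) (Subtype.ext h1)
            cases b <;> simp at h2 ⊢ <;> omega
        · right
          have hbb : (if b then l else 0) = if b' then l else 0 := by
            have hle' : (if b' then l else 0) ≤ l := by split_ifs <;> omega
            rcases hv.left_eq_or_eq (hlinkV b' c') with h1 | h1
            · exact (hinj hle hle' (Subtype.ext h1)).2
            · exact (hinj hle hle' (Subtype.ext h1)).2
          have hb : b' = b := by
            cases b <;> cases b' <;> simp at hbb ⊢ <;> omega
          subst hb
          cases c' <;> simp
      · rintro (rfl | rfl | rfl)
        · cases b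
          · exact (hlinkI c ⟨0, by omega⟩).inc_left
          · have := (hlinkI c ⟨l - 1, by omega⟩).inc_right
            simp only [Nat.sub_add_cancel hl] at this
            exact this
        · cases c
          · exact (hlinkV b false).inc_left
          · exact (hlinkV b false).inc_right
        · cases c
          · exact (hlinkV b true).inc_left
          · exact (hlinkV b true).inc_right
    rw [deg_eq_ncard, this, Set.ncard_insert_of_notMem, Set.ncard_pair]
    · rw [Ne, ψ.injective.eq_iff]; simp
    · simp only [Set.mem_insert_iff, Set.mem_singleton_iff, ψ.injective.eq_iff]
      simp
  refine ⟨hconn, isHyperelliptic_of_pairs hμ (by omega) (a := P false 0) (b := P true 0)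
    (hnec false (Nat.zero_le _) (Nat.zero_le _)) fun v => ?_, fun x => ?_⟩
  · obtain ⟨c, k, hk, rfl⟩ := hsurj v
    refine ⟨P (!c) k, ?_⟩
    rw [hδ c k hk, hδ' c k hk]
    cases c
    · simp only [Bool.not_false]
      abel
    · simp only [Bool.not_true]
      abel
  obtain ⟨c, i, hi, rfl⟩ := hsurj x
  -- firing any set creates a debt in the following divisors
  have hdebt : ∀ w ≤ l, ∀ S : Finset V(G), S.Nonempty → ∃ y ∈ S,
      (pt (P c 0) + pt (P c i) + pt (P c l) - pt (P (!c) w) : V(G) → ℤ) y < outdeg G.mult S y := by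
    intro w hw S hS
    by_contra! hle
    have hD0 : ∀ {y}, y ≠ P c 0 → y ≠ P c i → y ≠ P c l →
        (pt (P c 0) + pt (P c i) + pt (P c l) - pt (P (!c) w) : V(G) → ℤ) y ≤ 0 := by
      intro y h1 h2 h3
      simp only [Pi.sub_apply, Pi.add_apply, pt_apply, if_neg h1, if_neg h2, if_neg h3]
      split_ifs <;> omega
    have hY : ∀ k ≤ l, P (!c) k ∉ S := by
      have hout : ∀ k ≤ l, P (!c) k ∈ S → ∀ y, 0 < G.mult (P (!c) k) y → y ∈ S := by
        intro k hk hkS y hpos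
        by_contra hy
        have h1 := hle _ hkS
        have h2 := hD0 (y := P (!c) k) (hnec c (Nat.zero_le _) hk).symm (hnec c hi hk).symm
          (hnec c le_rfl hk).symm
        have h3 := Finset.single_le_sum (f := G.mult (P (!c) k)) (fun _ _ => Nat.zero_le _)
          (Finset.mem_compl.2 hy)
        rw [outdeg] at h1
        omega
      have hiff : ∀ j < l, (P (!c) j ∈ S ↔ P (!c) (j + 1) ∈ S) := fun j hj =>
        ⟨fun h1 => hout j hj.le h1 _ (hstep (!c) ⟨j, hj⟩), fun h1 => hout (j + 1) hj h1 _ (by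
          rw [mult_comm]; exact hstep (!c) ⟨j, hj⟩)⟩
      have hzero : ∀ k ≤ l, (P (!c) 0 ∈ S ↔ P (!c) k ∈ S) := fun k hk =>
        iff_of_le (u := fun k => P (!c) k ∈ S) (Nat.zero_le k) fun j _ hj => hiff j (by omega)
      have hwS : P (!c) w ∉ S := fun hwS => by
        have := hle _ hwS
        simp [pt_apply, (hnec c (Nat.zero_le _) hw).symm, (hnec c hi hw).symm,
          (hnec c le_rfl hw).symm] at this
        omega
      intro k hk hkS
      exact hwS ((hzero w hw).1 ((hzero k hk).2 hkS))
    -- an end of the path can be fired only if it carries two chips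
    have hends : ∀ b : Bool, i ≠ (if b then l else 0) → P c (if b then l else 0) ∉ S := by
      intro b hib hbS
      have hbl : (if b then l else 0) ≤ l := by split_ifs <;> omega
      have h1 := hle _ hbS
      have h2 : _ ≤ outdeg G.mult S (P c (if b then l else 0)) :=
        Finset.single_le_sum (f := G.mult (P c (if b then l else 0)))
          (fun _ _ => Nat.zero_le _) (Finset.mem_compl.2 (hY _ hbl))
      have h3 := hpar c b
      have h4 := hne (c := c) (c' := c) hbl hi hib.symm
      have h5 : P c 0 ≠ P c l := hne (Nat.zero_le _) le_rfl (by omega)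
      cases b
      · simp only [Bool.false_eq_true, if_false] at *
        simp [pt_apply, h4, h5, hnec c (Nat.zero_le _) hw] at h1
        omega
      · simp only [if_true] at *
        simp [pt_apply, h4, h5.symm, hnec c le_rfl hw] at h1
        omega
    have hwS := hY w hw
    by_cases hend : ∃ b : Bool, i = if b then l else 0
    · obtain ⟨b, rfl⟩ := hend
      have hother : P c (if (!b) then l else 0) ∉ S := hends _ (by cases b <;> simp <;> omega)
      have h5 : P c 0 ≠ P c l := hne (Nat.zero_le _) le_rfl (by omega)
      have h3 := hμ.three_le_outdeg (hdeg c b) hS hwS fun y hy hyb => by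
        have h1 := hle y hy
        have h2 := hD0 (y := y)
        have h4 : y ≠ P c (if (!b) then l else 0) := fun h => hother (h ▸ hy)
        cases b <;> simp at hyb h4 h2 h1 <;> have := h2 ‹_› ‹_› <;> omega
      have h1 := hle _ h3.1
      cases b
      · simp [pt_apply, h5, hnec c (Nat.zero_le _) hw] at h1 h3
        omega
      · simp [pt_apply, h5.symm, hnec c le_rfl hw] at h1 h3
        omega
    · push Not at hend
      have h0S : P c 0 ∉ S := hends false (hend false)
      have hlS : P c l ∉ S := hends true (hend true)
      have hcut := hμ.cut S hS ⟨_, Finset.mem_compl.2 hwS⟩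
      have h1 : ∑ y ∈ S, (outdeg G.mult S y : ℤ) ≤
          ∑ y ∈ S, (pt (P c 0) + pt (P c i) + pt (P c l) - pt (P (!c) w) : V(G) → ℤ) y :=
        Finset.sum_le_sum hle
      simp only [Pi.sub_apply, Pi.add_apply, Finset.sum_sub_distrib, Finset.sum_add_distrib,
        sum_pt, if_neg h0S, if_neg hlS, if_neg hwS] at h1
      have h2 : (2 : ℤ) ≤ ∑ y ∈ S, (outdeg G.mult S y : ℤ) := by exact_mod_cast hcut
      split_ifs at h1 <;> omega
  by_cases h2 : 2 * i ≤ l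
  · refine not_isWeierstrassPoint (v := P (!c) l) _ (hdebt (2 * i) h2) ?_
    rw [map_sub, map_add, map_add, hg]
    change (3 : ℤ) • cls G.mult (P c i) - cls G.mult (P (!c) l) = cls G.mult (P c 0) +
      cls G.mult (P c i) + cls G.mult (P c l) - cls G.mult (P (!c) (2 * i))
    rw [hδ c i hi, hδ c l le_rfl, hδ' c l le_rfl, hδ' c (2 * i) h2]
    push_cast
    module
  · refine not_isWeierstrassPoint (v := P (!c) 0) _ (hdebt (2 * i - l) (by omega)) ?_
    rw [map_sub, map_add, map_add, hg]
    change (3 : ℤ) • cls G.mult (P c i) - cls G.mult (P (!c) 0) = cls G.mult (P c 0) +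
      cls G.mult (P c i) + cls G.mult (P c l) - cls G.mult (P (!c) (2 * i - l))
    rw [hδ c i hi, hδ c l le_rfl, hδ' c (2 * i - l) (by omega), Nat.cast_sub (by omega)]
    push_cast
    module

end Families

end Graph

theorem theoremt {α β : Type*} (G : Graph α β) [Fintype V(G)] [Finite E(G)] [G.Loopless] :
    (G.IsEdgeConnected 2 ∧ G.IsHyperelliptic ∧ ∀ x : V(G), ¬ G.IsWeierstrassPoint x) ↔
      (∃ n : ℕ, 3 ≤ n ∧ G.IsIsomorphic (Graph.bananaGraph n)) ∨
      (∃ l : Fin 3 → ℕ, (∀ j, Odd (l j)) ∧ G.IsIsomorphic (Graph.pathsGraph l)) ∨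
      (∃ l : ℕ, 1 ≤ l ∧ G.IsIsomorphic (Graph.phiGraph l)) := by
  constructor
  · rintro ⟨hG, hh, hW⟩
    exact G.exists_isIsomorphic_of_no_weierstrassPoint hG hh hW
  · rintro (⟨n, hn, h⟩ | ⟨l, hl, h⟩ | ⟨l, hl, h⟩)
    · exact Graph.isHyperelliptic_and_no_weierstrassPoint_of_bananaGraph hn h
    · exact Graph.isHyperelliptic_and_no_weierstrassPoint_of_pathsGraph hl h
    · exact Graph.isHyperelliptic_and_no_weierstrassPoint_of_phiGraph hl h
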